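/- Let $\mathcal V$ be a finite-dimensional complex inner product space, let $L(\mathcal V)$ be the space of linear operators on $\mathcal V$, and let $\Phi : L(\mathcal V)\to L(\mathcal V)$ be a completely positive trace-preserving linear map with $\Phi^2=\Phi$. For a subspace $\mathcal X\subseteq\mathcal V$ identify $L(\mathcal X)$ with $\{\mu\in L(\mathcal V) : \Pi_{\mathcal X}\,\mu\,\Pi_{\mathcal X}=\mu\}$, where $\Pi_{\mathcal X}$ is the orthogonal projector onto $\mathcal X$; for a density operator $\rho$ on $\mathcal Z$ (positive semi-definite of trace $1$) let $\Gamma^{\rho}: L(\mathcal Z)\to L(\mathcal Z)$ be the map $\Gamma^{\rho}(\mu)=\mathrm{Tr}(\mu)\,\rho$. Then there is a unique subspace $\mathcal X\subseteq\mathcal V$ with the following two properties: (a) $\Phi[L(\mathcal V)]\subseteq L(\mathcal X)$; (b) there exist $n\ge 0$, finite-dimensional complex Euclidean spaces $\mathcal Y_1,\ldots,\mathcal Y_n,\mathcal Z_1,\ldots,\mathcal Z_n$, density operators $\rho_i$ on $\mathcal Z_i$ of rank $\dim\mathcal Z_i$, and an orthogonal decomposition $$\mathcal X=\bigoplus_{i=1}^n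 \mathcal Y_i\otimes\mathcal Z_i$$ (that is, isometric embeddings of the spaces $\mathcal Y_i\otimes\mathcal Z_i$ into $\mathcal V$ with mutually orthogonal ranges whose sum is $\mathcal X$) such that the restriction of $\Phi$ to $L(\mathcal X)$ is $$\Phi|_{L(\mathcal X)}=\bigoplus_{i=1}^n \mathrm{id}_{L(\mathcal Y_i)}\otimes\Gamma^{\rho_i},$$ where the direct sum of super-operators $\Psi_i$ on $L(\mathcal Y_i\otimes\mathcal Z_i)$ is the map $\mu\mapsto\sum_i\Psi_i(\Pi_i\,\mu\,\Pi_i)$, with $\Pi_i$ the orthogonal projector onto $\mathcal Y_i\otimes\mathcal Z_i$. Moreover, for every $\mathcal X$ satisfying (a) and every choice of $\mathcal Y_i,\mathcal Z_i,\rho_i$ and decomposition as in (b), the fixed space $\{\mu\in L(\mathcal V):\Phi(\mu)=\mu\}$ is the direct sum $\bigoplus_{i=1}^n L(\mathcal Y_i)\otimes\rho_i$. -/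

import Mathlib

open scoped TensorProduct

namespace CPTP

noncomputable section

/-- `L(X)`: the linear operators on a complex vector space `X`. -/
abbrev Op (X : Type*) [AddCommGroup X] [Module ℂ X] : Type _ := X →ₗ[ℂ] X

/-- `T(X)`: the linear super-operators on `L(X)`. -/
abbrev SuperOp (X : Type*) [AddCommGroup X] [Module ℂ X] : Type _ := Op X →ₗ[ℂ] Op X

/-- The complex Euclidean space of dimension `k`. -/
abbrev Euc (k : ℕ) : Type := EuclideanSpace ℂ (Fin k)

section Algebra

variable {X Y : Type*} [AddCommGroup X] [Module ℂ X] [FiniteDimensional ℂ X]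
  [AddCommGroup Y] [Module ℂ Y] [FiniteDimensional ℂ Y]

/-- The super-operator `Ψ ⊗ Ξ` on `L(X ⊗ Y) = L(X) ⊗ L(Y)`; it sends `A ⊗ B` to `Ψ A ⊗ Ξ B`. -/
def superTensor (Ψ : SuperOp X) (Ξ : SuperOp Y) : SuperOp (X ⊗[ℂ] Y) :=
  (homTensorHomEquiv ℂ X Y X Y).toLinearMap ∘ₗ TensorProduct.map Ψ Ξ ∘ₗ
    (homTensorHomEquiv ℂ X Y X Y).symm.toLinearMap

/-- `Γ^ρ`: the super-operator `μ ↦ Tr(μ) ρ`. -/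
def traceReplace (ρ : Op X) : SuperOp X := (LinearMap.trace ℂ X).smulRight ρ

/-- `Ψ` is trace-preserving. -/
def IsTracePreserving (Ψ : SuperOp X) : Prop :=
  ∀ μ : Op X, LinearMap.trace ℂ X (Ψ μ) = LinearMap.trace ℂ X μ

/-- The fixed space `{μ | Ψ μ = μ}` of a super-operator. -/
def fixedSpace (Ψ : SuperOp X) : Submodule ℂ (Op X) := LinearMap.eqLocus Ψ LinearMap.id

end Algebra

section Hilbert

variable {V : Type*} [NormedAddCommGroup V] [InnerProductSpace ℂ V] [FiniteDimensional ℂ V]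

/-- `Ψ` maps positive semi-definite operators to positive semi-definite operators
(by linearity it then also preserves Hermiticity). -/
def IsPositiveSuperOp (Ψ : SuperOp V) : Prop :=
  ∀ μ : Op V, μ.IsPositive → (Ψ μ).IsPositive

/-- `Ψ ⊗ id_{L(Y)}` is positive for every complex Euclidean space `Y`. -/
def IsCompletelyPositive (Ψ : SuperOp V) : Prop :=
  ∀ k : ℕ, IsPositiveSuperOp (superTensor Ψ (LinearMap.id : SuperOp (Euc k)))

/-- Density operators: positive semi-definite with trace one. -/
def IsDensityOperator (ρ : Op V) : Prop :=
  ρ.IsPositive ∧ LinearMap.trace ℂ V ρ = 1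

/-- The rank of `ρ` is the dimension of the space. -/
def IsFullRank (ρ : Op V) : Prop :=
  Module.finrank ℂ (LinearMap.range ρ) = Module.finrank ℂ V

/-- For a subspace `X` of `V`, the space `L(X)` seen inside `L(V)`: the operators `μ` with range in
`X` that vanish on the orthogonal complement of `X` (equivalently, `μ = Π_X μ Π_X`). -/
def operatorsOn (X : Submodule ℂ V) : Submodule ℂ (Op V) where
  carrier := {μ | (∀ v, μ v ∈ X) ∧ ∀ v ∈ Xᗮ, μ v = 0}
  zero_mem' := ⟨fun _ => X.zero_mem, fun _ _ => rfl⟩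
  add_mem' := fun {a b} ha hb =>
    ⟨fun v => X.add_mem (ha.1 v) (hb.1 v), fun v hv => by simp [ha.2 v hv, hb.2 v hv]⟩
  smul_mem' := fun c a ha =>
    ⟨fun v => X.smul_mem c (ha.1 v), fun v hv => by simp [ha.2 v hv]⟩

section Isometry

variable {W : Type*} [NormedAddCommGroup W] [InnerProductSpace ℂ W] [FiniteDimensional ℂ W]

/-- For an isometric embedding `U` of `W` into `V`, the embedding `A ↦ U A U*` of `L(W)` into
`L(V)`: the operator `A`, extended by zero on the orthogonal complement of `W`. -/
def extendOp (U : W →ₗᵢ[ℂ] V) : Op W →ₗ[ℂ] Op V where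
  toFun A := U.toLinearMap ∘ₗ A ∘ₗ LinearMap.adjoint U.toLinearMap
  map_add' A B := by ext; simp
  map_smul' c A := by ext; simp

/-- For an isometric embedding `U` of `W` into `V`, the compression `μ ↦ U* μ U` of operators
on `V` to operators on `W`. -/
def compressOp (U : W →ₗᵢ[ℂ] V) : Op V →ₗ[ℂ] Op W where
  toFun μ := LinearMap.adjoint U.toLinearMap ∘ₗ μ ∘ₗ U.toLinearMap
  map_add' A B := by ext; simp
  map_smul' c A := by ext; simp

end Isometry

/-- An orthogonal decomposition `X = ⨁ i, Y i ⊗ Z i` of a subspace `X` of `V`: complex Euclidean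
spaces `Y i`, `Z i` (of dimensions `dimY i`, `dimZ i`) together with identifications of the
`Y i ⊗ Z i` with mutually orthogonal subspaces of `V` whose sum is `X`. -/
structure TensorDecomposition (X : Submodule ℂ V) where
  /-- the number of summands -/
  n : ℕ
  /-- the dimension of `Y i` -/
  dimY : Fin n → ℕ
  /-- the dimension of `Z i` -/
  dimZ : Fin n → ℕ
  /-- the isometric embedding of `Y i ⊗ Z i` into `V` -/
  emb : ∀ i, (Euc (dimY i) ⊗[ℂ] Euc (dimZ i)) →ₗᵢ[ℂ] V
  /-- the summands are mutually orthogonal -/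
  orthogonal : OrthogonalFamily ℂ (fun i => Euc (dimY i) ⊗[ℂ] Euc (dimZ i)) emb
  /-- the summands span `X` -/
  iSup_range : ⨆ i, LinearMap.range (emb i).toLinearMap = X

namespace TensorDecomposition

variable {X : Submodule ℂ V} (D : TensorDecomposition X)

/-- The direct sum super-operator `⨁ i, id_{L(Y i)} ⊗ Γ^{ρ i}`: it applies
`id_{L(Y i)} ⊗ Γ^{ρ i}` to the `i`-th diagonal block of an operator and adds the results. -/
def superOp (ρ : ∀ i, Op (Euc (D.dimZ i))) : SuperOp V :=
  ∑ i, extendOp (D.emb i) ∘ₗ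
    superTensor (LinearMap.id : SuperOp (Euc (D.dimY i))) (traceReplace (ρ i)) ∘ₗ
    compressOp (D.emb i)

/-- The subspace `L(Y i) ⊗ ρ i = {A ⊗ ρ i | A ∈ L(Y i)}`, inside `L(V)`. -/
def block (ρ : ∀ i, Op (Euc (D.dimZ i))) (i : Fin D.n) : Submodule ℂ (Op V) :=
  LinearMap.range (extendOp (D.emb i) ∘ₗ
    (TensorProduct.mapBilinear (RingHom.id ℂ) (Euc (D.dimY i)) (Euc (D.dimZ i))
      (Euc (D.dimY i)) (Euc (D.dimZ i))).flip (ρ i))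

end TensorDecomposition

/-- `X = ⨁ i, Y i ⊗ Z i` through `D`, the `ρ i` are full-rank density operators on the `Z i`, and
the restriction of `Φ` to `L(X)` is `⨁ i, id_{L(Y i)} ⊗ Γ^{ρ i}`. -/
def HasBlockForm (Φ : SuperOp V) {X : Submodule ℂ V} (D : TensorDecomposition X)
    (ρ : ∀ i, Op (Euc (D.dimZ i))) : Prop :=
  (∀ i, IsDensityOperator (ρ i) ∧ IsFullRank (ρ i)) ∧
    ∀ μ ∈ operatorsOn X, Φ μ = D.superOp ρ μ

end Hilbert

end

end CPTP

/-! Write `P` for the projector onto the range of `Φ 1`. By Cauchy–Schwarz every value of `Φ` is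
supported on `P`, and any block form forces `X` to be this range, since the `ρ i` have full rank;
this gives uniqueness (`HasBlockForm.eq_range`).

For existence, pass to the Heisenberg dual, which is completely positive, idempotent and unital, and
compress it by `P` to a map `F` (`compDual`). The functional `a ↦ Tr (a Φ(1))` is `F`-invariant and
faithful on operators supported on `P`. Hence, for a fixed point `a` of `F`, the Kadison–Schwarz
defect `F(a* a) - a* a` vanishes. So the fixed points form a self-adjoint algebra `A`, and `F` is an
`A`-bimodule map onto it (`compDual_mul_right`, `compDual_mul_left`).

By `IsStarClosed.exists_columns`, `A` is a direct sum of full matrix algebras, each described by a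
minimal projector `p` and partial isometries `a k` with `(a k)* (a l) = δ p`. Take `Z` to be the
range of `p` and `Y` the index space of the `a k`, embedded by `y ⊗ z ↦ ∑ k, y k • a k z`. As `p
F(x) p` is a multiple of `p`, duality gives `Φ |a z⟩⟨b w| = ⟨w, z⟩ a (Φ(p) / Tr p) b*` for `a, b ∈
A` and `z, w` in the range of `p` (`trace_smul_map_ketbra`). This is `id ⊗ Γ^ρ` with `ρ = Φ(p) / Tr
p`, of full rank on `Z` by faithfulness. Cross terms between different summands vanish.

The fixed space is read off from the block form, as a fixed operator lies in the range of `Φ`. -/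

set_option linter.unusedSectionVars false

open scoped InnerProductSpace ComplexOrder

namespace CPTP

/-! ### Rank-one operators and the trace pairing. -/

section RankOne

variable {V : Type*} [NormedAddCommGroup V] [InnerProductSpace ℂ V] [FiniteDimensional ℂ V]

/-- The rank-one operator `|v⟩⟨w|`. -/
noncomputable def ketbra (v w : V) : Op V := (innerₛₗ ℂ w).smulRight v

@[simp] lemma ketbra_apply (v w x : V) : ketbra v w x = ⟪w, x⟫_ℂ • v := rfl

lemma ketbra_add_left (v v' w : V) : ketbra (v + v') w = ketbra v w + ketbra v' w := by
  ext x; simp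

lemma ketbra_add_right (v w w' : V) : ketbra v (w + w') = ketbra v w + ketbra v w' := by
  ext x; simp [add_smul]

@[simp] lemma ketbra_zero_left (w : V) : ketbra 0 w = 0 := by ext x; simp

@[simp] lemma ketbra_zero_right (v : V) : ketbra v 0 = 0 := by ext x; simp

lemma mul_ketbra (a : Op V) (v w : V) : a * ketbra v w = ketbra (a v) w := by
  ext x; simp

lemma star_apply_inner (a : Op V) (v w : V) : ⟪(star a) v, w⟫_ℂ = ⟪v, a w⟫_ℂ :=
  LinearMap.adjoint_inner_left _ _ _

lemma inner_star_apply (a : Op V) (v w : V) : ⟪v, (star a) w⟫_ℂ = ⟪a v, w⟫_ℂ :=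
  LinearMap.adjoint_inner_right _ _ _

lemma ketbra_mul (a : Op V) (v w : V) : ketbra v w * a = ketbra v (star a w) := by
  ext x; simp [star_apply_inner]

lemma op_ext_inner {a b : Op V} (h : ∀ v w, ⟪v, a w⟫_ℂ = ⟪v, b w⟫_ℂ) : a = b := by
  ext w; exact ext_inner_left ℂ fun v => h v w

lemma op_eq_zero_of_inner_self {a : Op V} (h : ∀ v, ⟪v, a v⟫_ℂ = 0) : a = 0 := by
  rw [← inner_map_self_eq_zero]
  intro v
  rw [← inner_conj_symm, h v, map_zero]

lemma star_ketbra (v w : V) : star (ketbra v w) = ketbra w v := by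
  apply op_ext_inner
  intro x y
  rw [inner_star_apply]
  simp

@[simp] lemma trace_ketbra (v w : V) : LinearMap.trace ℂ V (ketbra v w) = ⟪w, v⟫_ℂ := by
  rw [ketbra, LinearMap.trace_smulRight]; simp

lemma trace_mul_ketbra (a : Op V) (v w : V) :
    LinearMap.trace ℂ V (a * ketbra v w) = ⟪w, a v⟫_ℂ := by
  rw [mul_ketbra, trace_ketbra]

lemma eq_sum_ketbra {ι : Type*} [Fintype ι] (b : OrthonormalBasis ι ℂ V) (a : Op V) :
    a = ∑ i, ketbra (a (b i)) (b i) := by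
  ext x
  conv_lhs => rw [← b.sum_repr' x]
  simp [map_sum]

lemma op_ext_trace {a b : Op V}
    (h : ∀ x, LinearMap.trace ℂ V (x * a) = LinearMap.trace ℂ V (x * b)) : a = b := by
  apply op_ext_inner
  intro v w
  have := h (ketbra w v)
  rwa [LinearMap.trace_mul_comm, LinearMap.trace_mul_comm _ _ b, trace_mul_ketbra,
    trace_mul_ketbra] at this

/-- A linear map on `L(V)` is determined by its values on the `|v⟩⟨w|`. -/
lemma superOp_eq_on_operatorsOn {W : Type*} [AddCommGroup W] [Module ℂ W] {X : Submodule ℂ V}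
    {S T : Op V →ₗ[ℂ] W} (h : ∀ v ∈ X, ∀ w ∈ X, S (ketbra v w) = T (ketbra v w)) {μ : Op V}
    (hμ : μ ∈ operatorsOn X) : S μ = T μ := by
  let b := stdOrthonormalBasis ℂ V
  -- Since `μ` vanishes off `X`, it equals `μ` times the projector onto `X`; this puts both legs of
  -- each rank-one term in `X`.
  have key : μ = ∑ i, ketbra (μ (b i)) (X.starProjection (b i)) := by
    have h1 : μ = μ * (X.starProjection : V →L[ℂ] V).toLinearMap := by
      ext x
      have h2 := hμ.2 (x - X.starProjection x) (X.sub_starProjection_mem_orthogonal x)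
      rw [map_sub, sub_eq_zero] at h2
      simpa using h2
    conv_lhs => rw [h1, eq_sum_ketbra b μ, Finset.sum_mul]
    refine Finset.sum_congr rfl fun i _ => ?_
    rw [ketbra_mul]
    congr 1
    refine ext_inner_right ℂ fun y => ?_
    rw [star_apply_inner]
    simp [Submodule.inner_starProjection_left_eq_right]
  rw [key, map_sum, map_sum]
  exact Finset.sum_congr rfl fun i _ => h _ (hμ.1 _) _ (X.starProjection_apply_mem _)

end RankOne

/-! ### Complete positivity and its Cauchy–Schwarz consequences. -/

section SumPositive

variable {V : Type*} [NormedAddCommGroup V] [InnerProductSpace ℂ V] [FiniteDimensional ℂ V]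

/-- Complete positivity expressed through finite families of operators and vectors. -/
def SumPositive (Ψ : SuperOp V) : Prop :=
  ∀ (k : ℕ) (a : Fin k → Op V) (v : Fin k → V),
    0 ≤ ∑ i, ∑ j, ⟪v i, Ψ (star (a i) * a j) (v j)⟫_ℂ

lemma superTensor_map (Ψ : SuperOp V) {W : Type*} [AddCommGroup W] [Module ℂ W]
    [FiniteDimensional ℂ W] (Ξ : SuperOp W) (A : Op V) (B : Op W) :
    superTensor Ψ Ξ (TensorProduct.map A B) = TensorProduct.map (Ψ A) (Ξ B) := by
  have h : ∀ (A : Op V) (B : Op W),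
      homTensorHomEquiv ℂ V W V W (A ⊗ₜ B) = TensorProduct.map A B := by
    intro A B
    simp [homTensorHomEquiv_apply]
  rw [← h A B, ← h (Ψ A) (Ξ B)]
  simp only [superTensor, LinearMap.comp_apply, LinearEquiv.coe_coe,
    LinearEquiv.symm_apply_apply, TensorProduct.map_tmul]

/-- Apply positivity of `Ψ ⊗ id` to `T* T` with `T = ∑ a i ⊗ |e o⟩⟨e i|`, so that `T* T = ∑ (a i)*
(a j) ⊗ |e i⟩⟨e j|`, and test on `∑ v l ⊗ e l`. The index `o` is arbitrary, which is why `k = 0` is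
separate. -/
lemma IsCompletelyPositive.sumPositive {Ψ : SuperOp V} (h : IsCompletelyPositive Ψ) :
    SumPositive Ψ := by
  intro k a v
  rcases Nat.eq_zero_or_pos k with rfl | hk
  · simp
  let e := EuclideanSpace.basisFun (Fin k) ℂ
  let o : Fin k := ⟨0, hk⟩
  let T : Op (V ⊗[ℂ] Euc k) := ∑ i, TensorProduct.map (a i) (ketbra (e o) (e i))
  have hT : (LinearMap.adjoint T ∘ₗ T) =
      ∑ i, ∑ j, TensorProduct.map (star (a i) * a j) (ketbra (e i) (e j)) := by
    change LinearMap.adjoint T * T = _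
    simp only [T, map_sum, Finset.sum_mul_sum, TensorProduct.adjoint_map]
    refine Finset.sum_congr rfl fun i _ => Finset.sum_congr rfl fun j _ => ?_
    rw [Module.End.mul_eq_comp, ← TensorProduct.map_comp]
    congr 1
    rw [← LinearMap.star_eq_adjoint, star_ketbra]
    ext x : 1
    simp [e]
  have h1 := h k _ (LinearMap.isPositive_adjoint_comp_self T)
  rw [hT] at h1
  have h2 := h1.inner_nonneg_right (∑ l, v l ⊗ₜ e l)
  simp only [map_sum, LinearMap.sum_apply, superTensor_map, TensorProduct.map_tmul, sum_inner,
    inner_sum, TensorProduct.inner_tmul, LinearMap.id_apply, ketbra_apply] at h2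
  have he : ∀ i j, ⟪e i, e j⟫_ℂ = if i = j then 1 else 0 :=
    orthonormal_iff_ite.mp e.orthonormal
  simp only [he, inner_smul_right, mul_ite, mul_one, mul_zero,
    Finset.sum_ite_eq', Finset.mem_univ, if_true] at h2
  rwa [Finset.sum_comm]

lemma SumPositive.two {Ψ : SuperOp V} (h : SumPositive Ψ) (a b : Op V) (v w : V) :
    0 ≤ ⟪v, Ψ (star a * a) v⟫_ℂ + ⟪v, Ψ (star a * b) w⟫_ℂ +
      (⟪w, Ψ (star b * a) v⟫_ℂ + ⟪w, Ψ (star b * b) w⟫_ℂ) := by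
  simpa [Fin.sum_univ_two] using h 2 ![a, b] ![v, w]

lemma SumPositive.one {Ψ : SuperOp V} (h : SumPositive Ψ) (a : Op V) (v : V) :
    0 ≤ ⟪v, Ψ (star a * a) v⟫_ℂ := by
  simpa using h 1 ![a] ![v]

/-- Nonnegative complex numbers are real: vanishing of the imaginary part at `t = 1` and `t = i`
already determines `r`. -/
lemma conj_eq_of_forall_nonneg {p q r s : ℂ} (hp : 0 ≤ p) (hs : 0 ≤ s)
    (h : ∀ t : ℂ, 0 ≤ p + t * q + (star t * r + star t * t * s)) : r = star q := by
  have h1 := (h 1)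
  have h2 := (h Complex.I)
  rw [Complex.le_def] at *
  apply Complex.ext <;> simp at * <;> linarith

/-- A real-affine function of `t` bounded below is constant. This is the form in which
Cauchy–Schwarz is used: once the quadratic term is gone, the cross term must vanish. -/
lemma eq_zero_of_forall_nonneg {p q : ℂ}
    (h : ∀ t : ℂ, 0 ≤ p + t * q + star t * star q) : q = 0 := by
  by_contra hq
  have hn : 0 < Complex.normSq q := Complex.normSq_pos.mpr hq
  -- At this `t` the expression has real part `-p.re - 2`, while `t = 0` gives `0 ≤ p.re`.
  have h0 := h (-star q * ((p.re + 1) / Complex.normSq q : ℝ))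
  rw [Complex.le_def] at h0
  have h1 := h0.1
  simp only [Complex.add_re, Complex.mul_re, Complex.mul_im, Complex.neg_re, Complex.neg_im,
    Complex.ofReal_re, Complex.ofReal_im, star_mul', star_neg, Complex.star_def,
    Complex.conj_re, Complex.conj_im, Complex.zero_re, Complex.conj_ofReal] at h1
  have h2 : (p.re + 1) / Complex.normSq q * Complex.normSq q = p.re + 1 := by field_simp
  have h3 := (Complex.le_def.mp (h 0)).1
  simp at h3
  rw [Complex.normSq_apply] at h1 h2
  nlinarith

lemma SumPositive.inner_conj {Ψ : SuperOp V} (h : SumPositive Ψ) (a b : Op V) (v w : V) :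
    ⟪w, Ψ (star b * a) v⟫_ℂ = star ⟪v, Ψ (star a * b) w⟫_ℂ := by
  apply conj_eq_of_forall_nonneg (h.one a v) (h.one b w)
  intro t
  have := h.two a b v (t • w)
  simp only [map_smul, inner_smul_left, inner_smul_right] at this
  simpa [mul_assoc, mul_left_comm] using this

lemma SumPositive.map_star {Ψ : SuperOp V} (h : SumPositive Ψ) (a : Op V) :
    Ψ (star a) = star (Ψ a) := by
  apply op_ext_inner
  intro v w
  have := h.inner_conj 1 a w v
  simp only [mul_one, star_one, one_mul] at this
  rw [this, inner_star_apply, ← inner_conj_symm]; simp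

lemma SumPositive.isPositive_one {Ψ : SuperOp V} (h : SumPositive Ψ) : (Ψ 1).IsPositive := by
  rw [LinearMap.isPositive_iff]
  refine ⟨?_, fun v => ?_⟩
  · rw [LinearMap.isSymmetric_iff_isSelfAdjoint]
    change star _ = _
    rw [← h.map_star, star_one]
  · have := h.one 1 v
    rw [star_one, one_mul] at this
    rw [← inner_conj_symm]
    exact star_nonneg_iff.mpr this

/-- Every value of `Ψ` lives on the range of `Ψ 1`. -/
lemma SumPositive.range_le {Ψ : SuperOp V} (h : SumPositive Ψ) :
    LinearMap.range Ψ ≤ operatorsOn (LinearMap.range (Ψ 1)) := by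
  have hsa : star (Ψ 1) = Ψ 1 := by rw [← h.map_star, star_one]
  have hort : (LinearMap.range (Ψ 1))ᗮ = LinearMap.ker (Ψ 1) := by
    rw [LinearMap.orthogonal_range]
    exact congrArg LinearMap.ker hsa
  -- The quadratic term in `t` is `|t|² ⟨v, Ψ(1) v⟩ = 0`, so the cross term `⟨w, Ψ(μ) v⟩` vanishes.
  have key : ∀ μ : Op V, ∀ v ∈ LinearMap.ker (Ψ 1), Ψ μ v = 0 := by
    intro μ v hv
    rw [LinearMap.mem_ker] at hv
    refine ext_inner_left ℂ fun w => ?_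
    rw [inner_zero_right]
    apply eq_zero_of_forall_nonneg (p := ⟪w, Ψ (μ * star μ) w⟫_ℂ)
    intro t
    have h2 := h.two (star μ) 1 w (t • v)
    have h3 := h.inner_conj (star μ) 1 w v
    simp only [star_star, mul_one, one_mul, star_one, map_smul, inner_smul_right, inner_smul_left,
      hv, inner_zero_right, mul_zero, add_zero] at h2 h3
    rw [h3] at h2
    simpa using h2
  rintro _ ⟨μ, rfl⟩
  refine ⟨fun v => ?_, fun v hv => key μ v (hort ▸ hv)⟩
  rw [← Submodule.orthogonal_orthogonal (LinearMap.range (Ψ 1)), Submodule.mem_orthogonal]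
  intro u hu
  rw [hort] at hu
  have := key (star μ) u hu
  rw [← star_star μ, h.map_star, inner_star_apply, this, inner_zero_left]

end SumPositive

/-! ### The Heisenberg dual and faithfulness of the trace pairing. -/

section Dual

variable {V : Type*} [NormedAddCommGroup V] [InnerProductSpace ℂ V] [FiniteDimensional ℂ V]

/-- The Heisenberg-picture dual of a super-operator, for the pairing `(a, μ) ↦ Tr (a μ)`. -/
noncomputable def dualOp (Φ : SuperOp V) : SuperOp V where
  toFun a := ∑ i, ∑ j, LinearMap.trace ℂ V
    (a * Φ (ketbra (stdOrthonormalBasis ℂ V i) (stdOrthonormalBasis ℂ V j))) •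
      ketbra (stdOrthonormalBasis ℂ V j) (stdOrthonormalBasis ℂ V i)
  map_add' a b := by simp [add_mul, add_smul, Finset.sum_add_distrib]
  map_smul' c a := by simp [Finset.smul_sum, mul_smul]

lemma trace_dualOp_mul (Φ : SuperOp V) (a μ : Op V) :
    LinearMap.trace ℂ V (dualOp Φ a * μ) = LinearMap.trace ℂ V (a * Φ μ) := by
  let b := stdOrthonormalBasis ℂ V
  have hμ : μ = ∑ i, ∑ j, ⟪b j, μ (b i)⟫_ℂ • ketbra (b j) (b i) := by
    conv_lhs => rw [eq_sum_ketbra b μ]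
    refine Finset.sum_congr rfl fun i _ => ?_
    conv_lhs => rw [← b.sum_repr' (μ (b i))]
    ext x
    simp only [ketbra_apply, LinearMap.sum_apply, LinearMap.smul_apply, Finset.smul_sum]
    exact Finset.sum_congr rfl fun _ _ => smul_comm _ _ _
  conv_rhs => rw [hμ]
  have : ∀ i j, LinearMap.trace ℂ V (ketbra (b j) (b i) * μ) = ⟪b i, μ (b j)⟫_ℂ := by
    intro i j
    rw [LinearMap.trace_mul_comm, trace_mul_ketbra]
  simp only [dualOp, LinearMap.coe_mk, AddHom.coe_mk, Finset.sum_mul, map_sum, Finset.mul_sum,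
    map_smul, smul_mul_assoc, mul_smul_comm]
  rw [Finset.sum_comm]
  refine Finset.sum_congr rfl fun i _ => Finset.sum_congr rfl fun j _ => ?_
  change _ • LinearMap.trace ℂ V (ketbra (b i) (b j) * μ) = _
  rw [this, smul_eq_mul, smul_eq_mul, mul_comm]

lemma inner_dualOp (Φ : SuperOp V) (a : Op V) (v w : V) :
    ⟪w, dualOp Φ a v⟫_ℂ = LinearMap.trace ℂ V (a * Φ (ketbra v w)) := by
  rw [← trace_dualOp_mul, trace_mul_ketbra]

lemma dualOp_dualOp {Φ : SuperOp V} (h : Φ ∘ₗ Φ = Φ) (a : Op V) :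
    dualOp Φ (dualOp Φ a) = dualOp Φ a := by
  apply op_ext_inner
  intro v w
  rw [inner_dualOp, inner_dualOp, trace_dualOp_mul, ← LinearMap.comp_apply, h]

lemma dualOp_one {Φ : SuperOp V} (h : IsTracePreserving Φ) : dualOp Φ 1 = 1 := by
  apply op_ext_inner
  intro v w
  rw [inner_dualOp, one_mul, h, trace_ketbra]; rfl

/-- With `c i = |b o⟩⟨v i|` one has `|v j⟩⟨v i| = (c j)* (c i)`. Expanding the trace over the basis
turns the sum into one instance of the hypothesis on `Φ` for each basis vector `b m`, with the roles
of `i` and `j` exchanged. -/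
lemma SumPositive.dualOp {Φ : SuperOp V} (h : SumPositive Φ) : SumPositive (dualOp Φ) := by
  intro k a v
  let b := stdOrthonormalBasis ℂ V
  rcases isEmpty_or_nonempty (Fin (Module.finrank ℂ V)) with he | ⟨⟨o⟩⟩
  · have : Subsingleton V := by
      rw [← Module.finrank_zero_iff (R := ℂ)]
      by_contra hne
      exact he.false ⟨0, Nat.pos_of_ne_zero hne⟩
    have h0 : ∀ i, v i = 0 := fun i => Subsingleton.elim _ _
    simp [h0]
  have key : ∀ i j, ⟪v i, CPTP.dualOp Φ (star (a i) * a j) (v j)⟫_ℂ = ∑ m,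
      ⟪star (a j) (b m), Φ (star (ketbra (b o) (v j)) * ketbra (b o) (v i))
        (star (a i) (b m))⟫_ℂ := by
    intro i j
    rw [inner_dualOp, mul_assoc, LinearMap.trace_mul_comm, LinearMap.trace_eq_sum_inner _ b]
    refine Finset.sum_congr rfl fun m _ => ?_
    have : star (ketbra (b o) (v j)) * ketbra (b o) (v i) = ketbra (v j) (v i) := by
      rw [star_ketbra, mul_ketbra]
      simp
    rw [this, star_apply_inner]
    rfl
  simp only [key]
  rw [Finset.sum_comm]
  simp only [fun j => Finset.sum_comm (s := Finset.univ (α := Fin k)) (t := Finset.univ (α := Fin (Module.finrank ℂ V)))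
    (f := fun i m => ⟪star (a j) (b m), Φ (star (ketbra (b o) (v j)) * ketbra (b o) (v i))
        (star (a i) (b m))⟫_ℂ)]
  rw [Finset.sum_comm]
  exact Finset.sum_nonneg fun m _ => h k (fun i => ketbra (b o) (v i)) fun i => star (a i) (b m)

/-- Faithfulness of the trace pairing against a positive operator. -/
lemma mul_eq_zero_of_trace_mul_eq_zero {σ y : Op V} (hσ : σ.IsPositive) (hy : y.IsPositive)
    (h : LinearMap.trace ℂ V (y * σ) = 0) : y * σ = 0 := by
  have hs := hσ.isSymmetric
  let b := hs.eigenvectorBasis rfl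
  have hb : ∀ i, σ (b i) = (hs.eigenvalues rfl i : ℂ) • b i := hs.apply_eigenvectorBasis rfl
  -- In an eigenbasis of `σ` the trace is a sum of nonnegative terms, so each is zero: either the
  -- eigenvalue vanishes or the quadratic form of `y` does, and then `y (b i) = 0`.
  have hterm : ∀ i, ⟪b i, (y * σ) (b i)⟫_ℂ = hs.eigenvalues rfl i * ⟪b i, y (b i)⟫_ℂ := by
    intro i
    rw [Module.End.mul_apply, hb, map_smul, inner_smul_right]
  have hnn : ∀ i, 0 ≤ hs.eigenvalues rfl i := hσ.nonneg_eigenvalues rfl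
  rw [LinearMap.trace_eq_sum_inner _ b, Finset.sum_eq_zero_iff_of_nonneg] at h
  · apply b.toBasis.ext
    intro i
    have hi := h i (Finset.mem_univ _)
    rw [hterm, mul_eq_zero] at hi
    simp only [OrthonormalBasis.coe_toBasis, Module.End.mul_apply, LinearMap.zero_apply, hb, map_smul]
    rcases hi with hi | hi
    · simp [hi]
    · have hyb : y (b i) = 0 := by
        refine ext_inner_left ℂ fun w => ?_
        rw [inner_zero_right]
        apply eq_zero_of_forall_nonneg (p := ⟪w, y w⟫_ℂ)
        intro t
        have h2 := hy.inner_nonneg_right (w + t • b i)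
        have h3 : ⟪b i, y w⟫_ℂ = star ⟪w, y (b i)⟫_ℂ := by
          rw [← hy.isSymmetric, ← inner_conj_symm]; rfl
        simp only [map_add, map_smul, inner_add_left, inner_add_right, inner_smul_left,
          inner_smul_right, hi, h3] at h2
        simpa [add_right_comm] using h2
      simp [hyb]
  · intro i _
    rw [hterm]
    exact mul_nonneg (by exact_mod_cast hnn i) (hy.inner_nonneg_right _)

end Dual

/-! ### The compressed dual and its multiplicative domain. -/

section FixedAlgebra

variable {V : Type*} [NormedAddCommGroup V] [InnerProductSpace ℂ V] [FiniteDimensional ℂ V]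

/-- The orthogonal projector onto the range of `Φ 1`. -/
noncomputable def suppProj (Φ : SuperOp V) : Op V :=
  ((LinearMap.range (Φ 1)).starProjection : V →L[ℂ] V).toLinearMap

/-- The dual of `Φ`, compressed to the support of `Φ 1`. -/
noncomputable def compDual (Φ : SuperOp V) : SuperOp V where
  toFun a := suppProj Φ * dualOp Φ a * suppProj Φ
  map_add' a b := by simp [add_mul, mul_add]
  map_smul' c a := by simp

lemma compDual_apply (Φ : SuperOp V) (a : Op V) :
    compDual Φ a = suppProj Φ * dualOp Φ a * suppProj Φ := rfl

lemma suppProj_mul_self (Φ : SuperOp V) : suppProj Φ * suppProj Φ = suppProj Φ := by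
  ext x
  exact Submodule.starProjection_eq_self_iff.mpr (Submodule.starProjection_apply_mem _ x)

lemma star_suppProj (Φ : SuperOp V) : star (suppProj Φ) = suppProj Φ := by
  apply op_ext_inner
  intro v w
  rw [inner_star_apply]
  exact Submodule.inner_starProjection_left_eq_right _ _ _

lemma suppProj_apply_mem (Φ : SuperOp V) (v : V) : suppProj Φ v ∈ LinearMap.range (Φ 1) :=
  Submodule.starProjection_apply_mem _ v

lemma suppProj_apply_eq {Φ : SuperOp V} {v : V} (h : v ∈ LinearMap.range (Φ 1)) :
    suppProj Φ v = v :=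
  Submodule.starProjection_eq_self_iff.mpr h

variable {Φ : SuperOp V}

lemma suppProj_mul (hcp : SumPositive Φ) (μ : Op V) : suppProj Φ * Φ μ = Φ μ := by
  ext v
  exact suppProj_apply_eq ((hcp.range_le ⟨μ, rfl⟩).1 v)

lemma mul_suppProj (hcp : SumPositive Φ) (μ : Op V) : Φ μ * suppProj Φ = Φ μ := by
  have := congrArg star (suppProj_mul hcp (star μ))
  rwa [star_mul, star_suppProj, hcp.map_star, star_star] at this

lemma suppProj_mul_compDual (a : Op V) : suppProj Φ * compDual Φ a = compDual Φ a := by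
  rw [compDual_apply, ← mul_assoc, ← mul_assoc, suppProj_mul_self]

lemma compDual_mul_suppProj (a : Op V) : compDual Φ a * suppProj Φ = compDual Φ a := by
  rw [compDual_apply, mul_assoc, suppProj_mul_self]

/-- Values of `Φ` are supported on `P`, so pairing against them sees only the corner `P a P`. -/
lemma dualOp_compress (hcp : SumPositive Φ) (a : Op V) :
    dualOp Φ (suppProj Φ * a * suppProj Φ) = dualOp Φ a := by
  apply op_ext_inner
  intro v w
  rw [inner_dualOp, inner_dualOp, mul_assoc, suppProj_mul hcp, LinearMap.trace_mul_comm,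
    ← mul_assoc, mul_suppProj hcp, LinearMap.trace_mul_comm]

lemma compDual_compDual (hcp : SumPositive Φ) (hproj : Φ ∘ₗ Φ = Φ) (a : Op V) :
    compDual Φ (compDual Φ a) = compDual Φ a := by
  rw [compDual_apply Φ (compDual Φ a), compDual_apply, dualOp_compress hcp, dualOp_dualOp hproj]

lemma sumPositive_compDual (hcp : SumPositive Φ) : SumPositive (compDual Φ) := by
  intro k a v
  convert hcp.dualOp k a (fun i => suppProj Φ (v i)) using 3 with i _ j _
  conv_rhs => rw [← star_suppProj, star_apply_inner, star_suppProj]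
  rfl

/-- The Kadison–Schwarz inequality. -/
lemma compDual_schwarz (hcp : SumPositive Φ) (htp : IsTracePreserving Φ) (a : Op V) (v : V) :
    0 ≤ ⟪v, (compDual Φ (star a * a) - star (compDual Φ a) * compDual Φ a) v⟫_ℂ := by
  have hF := sumPositive_compDual hcp
  -- Since `F(1) = P` fixes `F(a) v`, this choice of first vector completes the square.
  have h := hF.two 1 a (-(compDual Φ a v)) v
  have h1 : compDual Φ 1 = suppProj Φ := by
    rw [compDual_apply, dualOp_one htp, mul_one, suppProj_mul_self]
  have h2 : suppProj Φ (compDual Φ a v) = compDual Φ a v :=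
    LinearMap.congr_fun (suppProj_mul_compDual a) v
  simp only [star_one, one_mul, mul_one, h1, map_neg, h2, hF.map_star, inner_neg_left,
    inner_neg_right, inner_star_apply] at h
  rw [LinearMap.sub_apply, Module.End.mul_apply, inner_sub_right, inner_star_apply]
  convert h using 1
  ring

/-- Invariance of the functional `Tr (· Φ(1))`, which holds because `Φ(1)` is itself fixed by `Φ`.
-/
lemma trace_compDual_mul (hcp : SumPositive Φ) (hproj : Φ ∘ₗ Φ = Φ) (a : Op V) :
    LinearMap.trace ℂ V (compDual Φ a * Φ 1) = LinearMap.trace ℂ V (a * Φ 1) := by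
  rw [compDual_apply, mul_assoc, suppProj_mul hcp, mul_assoc, LinearMap.trace_mul_comm, mul_assoc,
    mul_suppProj hcp, trace_dualOp_mul, ← LinearMap.comp_apply, hproj]

/-- The Schwarz defect `y` is positive and has zero expectation in the invariant functional, so `y
Φ(1) = 0`. As `y = y P` and `P` projects onto the range of `Φ(1)`, `y = 0`. -/
lemma compDual_star_mul_self (hcp : SumPositive Φ) (htp : IsTracePreserving Φ)
    (hproj : Φ ∘ₗ Φ = Φ) {a : Op V} (ha : compDual Φ a = a) :
    compDual Φ (star a * a) = star a * a := by
  have hF := sumPositive_compDual hcp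
  set y := compDual Φ (star a * a) - star a * a with hy
  have haP : a * suppProj Φ = a := by rw [← ha, compDual_mul_suppProj]
  have hyP : y * suppProj Φ = y := by
    rw [hy, sub_mul, compDual_mul_suppProj, mul_assoc, haP]
  have hpos : y.IsPositive := by
    rw [LinearMap.isPositive_iff]
    constructor
    · rw [LinearMap.isSymmetric_iff_isSelfAdjoint]
      change star _ = _
      rw [hy, star_sub, ← hF.map_star, star_mul, star_star]
    · intro v
      have := compDual_schwarz hcp htp a v
      rw [ha] at this
      rw [← inner_conj_symm]
      exact star_nonneg_iff.mpr this
  have h0 : y * Φ 1 = 0 := by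
    apply mul_eq_zero_of_trace_mul_eq_zero hcp.isPositive_one hpos
    rw [hy, sub_mul, map_sub, trace_compDual_mul hcp hproj, sub_self]
  have : y = 0 := by
    rw [← hyP]
    ext v
    obtain ⟨w, hw⟩ := suppProj_apply_mem Φ v
    rw [Module.End.mul_apply, ← hw]
    exact LinearMap.congr_fun h0 w
  exact sub_eq_zero.mp this

/-- Fixed points of the compressed dual are in its multiplicative domain. -/
lemma compDual_mul_right (hcp : SumPositive Φ) (htp : IsTracePreserving Φ)
    (hproj : Φ ∘ₗ Φ = Φ) {a : Op V} (ha : compDual Φ a = a) (x : Op V) :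
    compDual Φ (x * a) = compDual Φ x * a := by
  have hF := sumPositive_compDual hcp
  rw [← sub_eq_zero]
  apply op_eq_zero_of_inner_self
  intro v
  apply eq_zero_of_forall_nonneg
    (p := ⟪v, (compDual Φ (x * star x) - compDual Φ x * star (compDual Φ x)) v⟫_ℂ)
  intro t
  -- For fixed `a` the `|t|²` terms of the Schwarz inequality at `x* + t a` cancel, so the term
  -- linear in `t` must vanish.
  have h := compDual_schwarz hcp htp (star x + t • a) v
  have e1 : star (compDual Φ (star x + t • a)) * compDual Φ (star x + t • a) =
      compDual Φ x * star (compDual Φ x) + t • (compDual Φ x * a) +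
        star t • star (compDual Φ x * a) + (t * star t) • (star a * a) := by
    simp only [map_add, map_smul, ha, hF.map_star, star_add, star_star, star_smul, star_mul,
      add_mul, mul_add, smul_mul_assoc, mul_smul_comm, smul_add, mul_smul]
    abel
  have e2 : compDual Φ (star (star x + t • a) * (star x + t • a)) =
      compDual Φ (x * star x) + t • compDual Φ (x * a) +
        star t • star (compDual Φ (x * a)) + (t * star t) • (star a * a) := by
    rw [← compDual_star_mul_self hcp htp hproj ha, ← hF.map_star]
    simp only [map_add, map_smul, star_add, star_star, star_smul, star_mul,
      add_mul, mul_add, smul_mul_assoc, mul_smul_comm, smul_add, mul_smul]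
    abel
  rw [e1, e2] at h
  have e3 : ∀ y : Op V, star ⟪v, y v⟫_ℂ = ⟪v, star y v⟫_ℂ := by
    intro y
    rw [inner_star_apply, ← inner_conj_symm]; simp
  rw [e3, star_sub]
  simp only [LinearMap.sub_apply, LinearMap.add_apply, LinearMap.smul_apply, inner_sub_right,
    inner_add_right, inner_smul_right] at h ⊢
  convert h using 1
  ring

lemma compDual_mul_left (hcp : SumPositive Φ) (htp : IsTracePreserving Φ)
    (hproj : Φ ∘ₗ Φ = Φ) {a : Op V} (ha : compDual Φ a = a) (x : Op V) :
    compDual Φ (a * x) = a * compDual Φ x := by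
  have hF := sumPositive_compDual hcp
  have ha' : compDual Φ (star a) = star a := by rw [hF.map_star, ha]
  have := congrArg star (compDual_mul_right hcp htp hproj ha' (star x))
  rwa [← hF.map_star, star_mul, star_star, star_star, star_mul, star_star, hF.map_star,
    star_star] at this

end FixedAlgebra

/-! ### Structure of finite-dimensional self-adjoint operator algebras. -/

section StarAlgebra

variable {V : Type*} [NormedAddCommGroup V] [InnerProductSpace ℂ V] [FiniteDimensional ℂ V]

/-- `A` is closed under products and adjoints. -/
structure IsStarClosed (A : Submodule ℂ (Op V)) : Prop where
  mul_mem : ∀ {a b : Op V}, a ∈ A → b ∈ A → a * b ∈ A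
  star_mem : ∀ {a : Op V}, a ∈ A → star a ∈ A

lemma op_eq_zero_of_star_mul_self {d : Op V} (h : star d * d = 0) : d = 0 := by
  ext v
  have := star_apply_inner (star d) v (d v)
  rw [star_star, ← Module.End.mul_apply, h, LinearMap.zero_apply, inner_zero_right] at this
  exact inner_self_eq_zero.mp this

variable {A : Submodule ℂ (Op V)}

/-- `A` need not contain the identity of `V`, so only polynomials without constant term are
available. -/
lemma IsStarClosed.aeval_X_mul_mem (hA : IsStarClosed A) {y : Op V} (hy : y ∈ A)
    (g : Polynomial ℂ) : Polynomial.aeval y (Polynomial.X * g) ∈ A := by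
  induction g using Polynomial.induction_on with
  | C c => simpa [← Algebra.commutes, ← Algebra.smul_def] using A.smul_mem c hy
  | add f g hf hg => rw [mul_add, map_add]; exact A.add_mem hf hg
  | monomial n c h =>
    rw [← mul_assoc] at h
    rw [pow_succ, ← mul_assoc, ← mul_assoc, map_mul, Polynomial.aeval_X]
    exact hA.mul_mem h hy

/-- A nonzero self-adjoint element has a nonzero spectral projector. -/
lemma IsStarClosed.exists_spectral_projector (hA : IsStarClosed A) {y : Op V} (hy : y ∈ A)
    (hsa : star y = y) (h0 : y ≠ 0) :
    ∃ (c : ℂ) (e g : Op V), e ∈ A ∧ e ≠ 0 ∧ e * e = e ∧ star e = e ∧ y * e = c • e ∧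
      e = g * y := by
  classical
  have hs : y.IsSymmetric := (LinearMap.isSymmetric_iff_isSelfAdjoint y).mpr hsa
  let b := hs.eigenvectorBasis rfl
  let l : Fin (Module.finrank ℂ V) → ℂ := fun i => hs.eigenvalues rfl i
  have hb : ∀ i, y (b i) = l i • b i := hs.apply_eigenvectorBasis rfl
  obtain ⟨i₀, hi₀⟩ : ∃ i, l i ≠ 0 := by
    by_contra! hl
    apply h0
    apply b.toBasis.ext
    intro i
    simp [hb, hl]
  -- Adding `0` to the nodes makes the Lagrange polynomial vanish at `0`, so it is divisible by `X`
  -- and its value at `y` stays in `A`.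
  let s : Finset ℂ := insert 0 (Finset.univ.image l)
  let f := Lagrange.basis s id (l i₀)
  have hmem : ∀ i, l i ∈ s := fun i =>
    Finset.mem_insert_of_mem (Finset.mem_image_of_mem l (Finset.mem_univ i))
  have hf0 : f.eval 0 = 0 := Lagrange.eval_basis_of_ne (v := id) hi₀ (Finset.mem_insert_self _ _)
  have hf : ∀ i, f.eval (l i) = if l i = l i₀ then 1 else 0 := by
    intro i
    split_ifs with h
    · rw [h]
      exact Lagrange.eval_basis_self (v := id) Function.injective_id.injOn (hmem i₀)
    · exact Lagrange.eval_basis_of_ne (v := id) (Ne.symm h) (hmem i)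
  obtain ⟨g, hg⟩ : Polynomial.X ∣ f := by
    rwa [Polynomial.X_dvd_iff, Polynomial.coeff_zero_eq_eval_zero]
  have he : ∀ i, Polynomial.aeval y f (b i) = if l i = l i₀ then b i else 0 := by
    intro i
    have hev : Module.End.HasEigenvector y (l i) (b i) :=
      ⟨Module.End.mem_eigenspace_iff.mpr (hb i), b.orthonormal.ne_zero i⟩
    rw [Module.End.aeval_apply_of_hasEigenvector hev, hf]
    split_ifs <;> simp
  refine ⟨l i₀, Polynomial.aeval y f, Polynomial.aeval y g, ?_, ?_, ?_, ?_, ?_, ?_⟩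
  · rw [hg]; exact hA.aeval_X_mul_mem hy g
  · intro h
    have := he i₀
    rw [h, if_pos rfl] at this
    exact b.orthonormal.ne_zero i₀ this.symm
  · apply b.toBasis.ext
    intro i
    simp only [OrthonormalBasis.coe_toBasis, Module.End.mul_apply, he]
    split_ifs with h
    · rw [he, if_pos h]
    · simp
  · refine ((LinearMap.eq_adjoint_iff_basis b.toBasis b.toBasis _ _).mpr ?_).symm
    intro i j
    simp only [OrthonormalBasis.coe_toBasis, he]
    have hij := orthonormal_iff_ite.mp b.orthonormal i j
    by_cases h : i = j
    · subst h; split_ifs <;> simp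
    · rw [if_neg h] at hij
      split_ifs <;> simp [hij]
  · apply b.toBasis.ext
    intro i
    simp only [OrthonormalBasis.coe_toBasis, Module.End.mul_apply, he, LinearMap.smul_apply]
    split_ifs with h
    · rw [hb, h]
    · simp
  · rw [hg, mul_comm, map_mul, Polynomial.aeval_X]

/-- A self-adjoint algebra that is not zero contains a minimal projector. -/
lemma IsStarClosed.exists_minimal_projector (hA : IsStarClosed A) (hne : A ≠ ⊥) :
    ∃ p ∈ A, p ≠ 0 ∧ p * p = p ∧ star p = p ∧ ∀ x ∈ A, ∃ c : ℂ, p * x * p = c • p := by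
  classical
  have hex : ∃ n, ∃ p ∈ A, p ≠ 0 ∧ p * p = p ∧ star p = p ∧
      Module.finrank ℂ (LinearMap.range p) = n := by
    obtain ⟨a, ha, ha0⟩ := (Submodule.ne_bot_iff A).mp hne
    obtain ⟨_, e, _, he, he0, hee, hes, _⟩ := hA.exists_spectral_projector
      (hA.mul_mem (hA.star_mem ha) ha) (by rw [star_mul, star_star])
      (fun h => ha0 (op_eq_zero_of_star_mul_self h))
    exact ⟨_, e, he, he0, hee, hes, rfl⟩
  obtain ⟨p, hp, hp0, hpp, hps, hrank⟩ := Nat.find_spec hex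
  -- Here `p` has the least rank among nonzero projectors of `A`. A spectral projector of `y = y p`
  -- lies under `p`, hence equals `p`, and `y` is its eigenvalue times `p`.
  have key : ∀ y ∈ A, star y = y → y * p = y → ∃ c : ℂ, y = c • p := by
    intro y hy hys hyp
    by_cases hy0 : y = 0
    · exact ⟨0, by simp [hy0]⟩
    obtain ⟨c, e, g, he, he0, hee, hes, hye, hg⟩ := hA.exists_spectral_projector hy hys hy0
    have hep : e * p = e := by rw [hg, mul_assoc, hyp]
    have hpe : p * e = e := by
      have := congrArg star hep
      rwa [star_mul, hes, hps] at this
    have hle : LinearMap.range e ≤ LinearMap.range p := by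
      rintro _ ⟨v, rfl⟩
      exact ⟨e v, LinearMap.congr_fun hpe v⟩
    have hmin := Nat.find_min' hex ⟨e, he, he0, hee, hes, rfl⟩
    have heq := Submodule.eq_of_le_of_finrank_le hle (by rw [hrank]; exact hmin)
    have : e = p := by
      rw [← hep]
      ext v
      obtain ⟨w, hw⟩ : p v ∈ LinearMap.range e := heq ▸ ⟨v, rfl⟩
      rw [Module.End.mul_apply, ← hw]
      exact LinearMap.congr_fun hee w
    exact ⟨c, by rw [← hyp, ← this, hye]⟩
  refine ⟨p, hp, hp0, hpp, hps, fun x hx => ?_⟩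
  have hsx := hA.star_mem hx
  obtain ⟨c₁, h₁⟩ := key (p * (x + star x) * p)
    (hA.mul_mem (hA.mul_mem hp (A.add_mem hx hsx)) hp)
    (by rw [star_mul, star_mul, star_add, star_star, hps, add_comm, mul_assoc])
    (by rw [mul_assoc, hpp])
  obtain ⟨c₂, h₂⟩ := key (p * (Complex.I • (x - star x)) * p)
    (hA.mul_mem (hA.mul_mem hp (A.smul_mem _ (A.sub_mem hx hsx))) hp)
    (by
      rw [star_mul, star_mul, star_smul, star_sub, star_star, hps, ← mul_assoc]
      congr 2
      rw [Complex.star_def, Complex.conj_I, neg_smul, ← smul_neg, neg_sub])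
    (by rw [mul_assoc, hpp])
  -- General `x` reduces to the self-adjoint elements `x + x*` and `i (x - x*)`.
  refine ⟨(c₁ - Complex.I * c₂) / 2, ?_⟩
  have hI : Complex.I • (p * (Complex.I • (x - star x)) * p) = -(p * (x - star x) * p) := by
    rw [mul_smul_comm, smul_mul_assoc, smul_smul, Complex.I_mul_I, neg_one_smul]
  have h3 : p * x * p = (2⁻¹ : ℂ) • (p * (x + star x) * p -
      Complex.I • (p * (Complex.I • (x - star x)) * p)) := by
    rw [hI]
    simp only [mul_add, add_mul, mul_sub, sub_mul]
    module
  rw [h3, h₁, h₂]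
  module

/-- A projector `p` with a column `a` of partial isometries having initial projector `p`. -/
structure MatrixColumn (V : Type*) [NormedAddCommGroup V] [InnerProductSpace ℂ V] where
  /-- the number of partial isometries -/
  m : ℕ
  /-- the initial projector -/
  p : Op V
  /-- the partial isometries -/
  a : Fin m → Op V

/-- The sum of the final projectors of a column of partial isometries. -/
noncomputable def MatrixColumn.unit (B : MatrixColumn V) : Op V := ∑ k, B.a k * star (B.a k)

/-- The column `B` spans the left ideal of `A` generated by the minimal projector `B.p`. -/
structure MatrixColumn.IsMinimalIn (B : MatrixColumn V) (A : Submodule ℂ (Op V)) : Prop where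
  p_mem : B.p ∈ A
  p_ne_zero : B.p ≠ 0
  p_mul_p : B.p * B.p = B.p
  star_p : star B.p = B.p
  a_mem : ∀ k, B.a k ∈ A
  star_a_mul : ∀ k l, star (B.a k) * B.a l = if k = l then B.p else 0
  minimal : ∀ x ∈ A, ∃ c : ℂ, B.p * x * B.p = c • B.p

lemma MatrixColumn.IsMinimalIn.a_mul_p {B : MatrixColumn V} (hB : B.IsMinimalIn A)
    (k : Fin B.m) : B.a k * B.p = B.a k := by
  rw [← sub_eq_zero]
  apply op_eq_zero_of_star_mul_self
  have h := hB.star_a_mul k k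
  rw [if_pos rfl] at h
  rw [star_sub, star_mul, hB.star_p]
  simp only [sub_mul, mul_sub]
  rw [← mul_assoc, h, mul_assoc B.p, h, mul_assoc, ← mul_assoc (star _), h, hB.p_mul_p, hB.p_mul_p]
  simp

/-- For a unit vector `z` in the range of `p`, minimality gives `p x p = ⟨z, x z⟩ p` on `A`, so `(a
p)* (b p) = ⟨a z, b z⟩ p`. The left ideal `A p` is thus modelled by the subspace `A z` of `V`, and
an orthonormal basis of `A z` lifts to the column. -/
lemma IsStarClosed.exists_column (hA : IsStarClosed A) (hne : A ≠ ⊥) :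
    ∃ B : MatrixColumn V, B.IsMinimalIn A ∧ ∀ x ∈ A, B.unit * (x * B.p) = x * B.p := by
  obtain ⟨p, hp, hp0, hpp, hps, hmin⟩ := hA.exists_minimal_projector hne
  obtain ⟨z, hz, hz1⟩ : ∃ z, p z = z ∧ ⟪z, z⟫_ℂ = 1 := by
    obtain ⟨v, hv⟩ : ∃ v, p v ≠ 0 := by
      by_contra! h
      exact hp0 (LinearMap.ext h)
    refine ⟨((‖p v‖⁻¹ : ℝ) : ℂ) • p v, ?_, ?_⟩
    · rw [map_smul, ← Module.End.mul_apply, hpp]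
    · have : ‖p v‖ ≠ 0 := norm_ne_zero_iff.mpr hv
      rw [inner_self_eq_norm_sq_to_K, norm_smul]
      simp [this]
  have hcoef : ∀ x ∈ A, p * x * p = ⟪z, x z⟫_ℂ • p := by
    intro x hx
    obtain ⟨c, hc⟩ := hmin x hx
    have h1 : ⟪z, (p * x * p) z⟫_ℂ = ⟪z, x z⟫_ℂ := by
      rw [Module.End.mul_apply, Module.End.mul_apply, hz]
      conv_lhs => rw [← hps, inner_star_apply, hz]
    rw [hc, LinearMap.smul_apply, hz, inner_smul_right, hz1, mul_one] at h1
    rw [hc, h1]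
  let Y : Submodule ℂ V := A.map (LinearMap.applyₗ z)
  have hY : ∀ x ∈ A, x z ∈ Y := fun x hx => ⟨x, hx, rfl⟩
  let b := stdOrthonormalBasis ℂ Y
  have hex : ∀ k, ∃ a ∈ A, a z = b k := fun k => (b k).2
  choose a ha haz using hex
  have hapz : ∀ k, (a k * p) z = b k := fun k => by rw [Module.End.mul_apply, hz, haz]
  have hort : ∀ k l, star (a k * p) * (a l * p) = if k = l then p else 0 := by
    intro k l
    have h1 : star (a k * p) * (a l * p) = p * (star (a k) * a l) * p := by
      rw [star_mul, hps]; simp only [mul_assoc]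
    rw [h1, hcoef _ (hA.mul_mem (hA.star_mem (ha k)) (ha l)), Module.End.mul_apply,
      inner_star_apply, haz, haz, ← Submodule.coe_inner, orthonormal_iff_ite.mp b.orthonormal]
    split_ifs <;> simp
  let B : MatrixColumn V := ⟨_, p, fun k => a k * p⟩
  have hunit : ∀ w ∈ Y, B.unit w = w := by
    intro w hw
    have h1 : ∀ l, B.unit (b l : V) = b l := by
      intro l
      have : B.unit * (a l * p) = a l * p := by
        simp only [MatrixColumn.unit, B, Finset.sum_mul]
        simp only [mul_assoc (_ * p) (star _), hort, mul_ite, mul_zero, Finset.sum_ite_eq',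
          Finset.mem_univ, if_true]
        rw [mul_assoc, hpp]
      rw [← hapz, ← Module.End.mul_apply, this]
    have h2 := congrArg Subtype.val (b.sum_repr ⟨w, hw⟩)
    simp only [Submodule.coe_sum, Submodule.coe_smul] at h2
    rw [← h2, map_sum]
    simp only [map_smul, h1]
  have hunitA : B.unit ∈ A := A.sum_mem fun k _ =>
    hA.mul_mem (hA.mul_mem (ha k) hp) (hA.star_mem (hA.mul_mem (ha k) hp))
  refine ⟨B, ⟨hp, hp0, hpp, hps, fun k => hA.mul_mem (ha k) hp, hort, hmin⟩, ?_⟩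
  intro x hx
  rw [← sub_eq_zero]
  set d := B.unit * (x * B.p) - x * B.p with hd
  have hdp : d * p = d := by
    rw [hd, sub_mul, mul_assoc, mul_assoc x, hpp]
  have hdA : d ∈ A := A.sub_mem (hA.mul_mem hunitA (hA.mul_mem hx hp)) (hA.mul_mem hx hp)
  have hdz : d z = 0 := by
    have h1 : (x * B.p) z = x z := by
      rw [Module.End.mul_apply]; exact congrArg x hz
    rw [hd, LinearMap.sub_apply, Module.End.mul_apply, h1, hunit _ (hY x hx), sub_self]
  -- As `d = d p` and `d z = 0`, one gets `d* d = p d* d p = ⟨z, d* d z⟩ p = 0`.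
  apply op_eq_zero_of_star_mul_self
  have h2 := hcoef _ (hA.mul_mem (hA.star_mem hdA) hdA)
  rw [Module.End.mul_apply, hdz, map_zero, inner_zero_right, zero_smul] at h2
  rw [← hdp, star_mul, hps, ← h2]
  simp only [mul_assoc]

/-- The structure of finite-dimensional self-adjoint operator algebras. -/
theorem IsStarClosed.exists_columns (hA : IsStarClosed A) :
    ∃ L : List (MatrixColumn V), (∀ B ∈ L, B.IsMinimalIn A) ∧
      L.Pairwise (fun B B' => ∀ x ∈ A, B.p * x * B'.p = 0) ∧
      ∀ x ∈ A, x * (L.map MatrixColumn.unit).sum = x := by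
  induction hn : Module.finrank ℂ A using Nat.strong_induction_on generalizing A with
  | _ n ih =>
  by_cases hne : A = ⊥
  · refine ⟨[], by simp, List.Pairwise.nil, fun x hx => ?_⟩
    rw [hne, Submodule.mem_bot] at hx
    simp [hx]
  obtain ⟨B, hB, hq⟩ := hA.exists_column hne
  set q := B.unit with hqdef
  have hqA : q ∈ A := A.sum_mem fun k _ => hA.mul_mem (hB.a_mem k) (hA.star_mem (hB.a_mem k))
  have hqs : star q = q := by simp [hqdef, MatrixColumn.unit]
  -- The unit `q` of the column is a left unit for the ideal `A q`; taking adjoints then shows that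
  -- `q` is central in `A`.
  have hqxq : ∀ x ∈ A, q * (x * q) = x * q := by
    intro x hx
    have h1 : ∀ k, q * (x * B.a k) = x * B.a k := by
      intro k
      have := hq _ (hA.mul_mem hx (hB.a_mem k))
      rwa [mul_assoc, hB.a_mul_p] at this
    have h2 : x * q = ∑ k, (x * B.a k) * star (B.a k) := by
      rw [hqdef, MatrixColumn.unit, Finset.mul_sum]
      simp only [mul_assoc]
    rw [h2, Finset.mul_sum]
    refine Finset.sum_congr rfl fun k _ => ?_
    rw [← mul_assoc, h1]
  have hcomm : ∀ x ∈ A, q * x = x * q := by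
    intro x hx
    have := congrArg star (hqxq _ (hA.star_mem hx))
    simp only [star_mul, star_star, hqs] at this
    rw [← this, mul_assoc, hqxq x hx]
  have hqp : q * B.p = B.p := by
    have := hq _ hB.p_mem
    rwa [hB.p_mul_p] at this
  have hpq : B.p * q = B.p := by rw [← hcomm _ hB.p_mem, hqp]
  have hqq : q * q = q := by
    have h1 : ∀ k, q * B.a k = B.a k := by
      intro k
      have := hq _ (hB.a_mem k)
      rwa [hB.a_mul_p] at this
    conv_lhs => rw [hqdef]; arg 2; rw [MatrixColumn.unit]
    rw [Finset.mul_sum]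
    conv_rhs => rw [hqdef, MatrixColumn.unit]
    refine Finset.sum_congr rfl fun k _ => ?_
    rw [← mul_assoc, ← hqdef, h1]
  -- Induct on the complementary ideal `A (1 - q)`; it is strictly smaller because `p q = p ≠ 0`.
  let A' : Submodule ℂ (Op V) := A ⊓ LinearMap.ker (LinearMap.mulRight ℂ q)
  have hA'mem : ∀ x, x ∈ A' ↔ x ∈ A ∧ x * q = 0 := fun x => by simp [A']
  have hA' : IsStarClosed A' := by
    constructor
    · intro a b ha hb
      rw [hA'mem] at *
      exact ⟨hA.mul_mem ha.1 hb.1, by rw [mul_assoc, hb.2, mul_zero]⟩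
    · intro a ha
      rw [hA'mem] at *
      refine ⟨hA.star_mem ha.1, ?_⟩
      have := congrArg star ha.2
      rwa [← hcomm _ ha.1, star_mul, hqs, star_zero] at this
  have hlt : A' < A := by
    refine lt_of_le_of_ne inf_le_left fun h => hB.p_ne_zero ?_
    have : B.p ∈ A' := h ▸ hB.p_mem
    rw [← hpq, ((hA'mem _).mp this).2]
  obtain ⟨L, hL, hpair, hunit⟩ := ih _ (hn ▸ Submodule.finrank_lt_finrank_of_lt hlt) hA' rfl
  have hsub : ∀ x ∈ A, x - x * q ∈ A' := fun x hx => (hA'mem _).mpr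
    ⟨A.sub_mem hx (hA.mul_mem hx hqA), by rw [sub_mul, mul_assoc, hqq, sub_self]⟩
  have hpz : ∀ C ∈ L, q * C.p = 0 ∧ C.p * q = 0 := fun C hC => by
    have := (hA'mem _).mp (hL C hC).p_mem
    exact ⟨by rw [hcomm _ this.1, this.2], this.2⟩
  have hcut : ∀ x ∈ A, ∀ C ∈ L, (x - x * q) * C.p = x * C.p := fun x hx C hC => by
    rw [sub_mul, mul_assoc, (hpz C hC).1, mul_zero, sub_zero]
  refine ⟨B :: L, ?_, ?_, ?_⟩
  · intro C hC
    rcases List.mem_cons.mp hC with rfl | hC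
    · exact hB
    · have h := hL C hC
      refine ⟨((hA'mem _).mp h.p_mem).1, h.p_ne_zero, h.p_mul_p, h.star_p,
        fun k => ((hA'mem _).mp (h.a_mem k)).1, h.star_a_mul, fun x hx => ?_⟩
      obtain ⟨c, hc⟩ := h.minimal _ (hsub x hx)
      exact ⟨c, by rw [← hc, mul_assoc, mul_assoc, hcut x hx C hC]⟩
  · refine List.pairwise_cons.mpr ⟨fun C hC x hx => ?_, hpair.imp_of_mem ?_⟩
    · rw [← hpq, mul_assoc B.p, hcomm x hx, mul_assoc, mul_assoc, (hpz C hC).1, mul_zero, mul_zero]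
    · intro C D hC hD h x hx
      rw [mul_assoc, ← hcut x hx D hD, ← mul_assoc, h _ (hsub x hx)]
  · intro x hx
    rw [List.map_cons, List.sum_cons, mul_add]
    have hqL : q * (L.map MatrixColumn.unit).sum = 0 := by
      rw [← List.sum_map_mul_left]
      apply List.sum_eq_zero
      intro y hy
      simp only [List.mem_map] at hy
      obtain ⟨C, hC, rfl⟩ := hy
      rw [MatrixColumn.unit, Finset.mul_sum]
      refine Finset.sum_eq_zero fun k _ => ?_
      have := (hA'mem _).mp ((hL C hC).a_mem k)
      rw [← mul_assoc, hcomm _ this.1, this.2, zero_mul]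
    have h1 := hunit _ (hsub x hx)
    rw [sub_mul, mul_assoc, hqL, mul_zero, sub_zero] at h1
    rw [h1]
    abel

end StarAlgebra

/-! ### Tensor-product embeddings built from columns. -/

section Embedding

variable {V : Type*} [NormedAddCommGroup V] [InnerProductSpace ℂ V] [FiniteDimensional ℂ V]
  {A : Submodule ℂ (Op V)}

/-- The comparison maps `f'`, `g'` are left free so that identities give isometry and zero maps give
orthogonality of different summands. -/
lemma inner_eq_of_inner_tmul {Y Z Y' Z' W : Type*} [NormedAddCommGroup Y] [InnerProductSpace ℂ Y]
    [NormedAddCommGroup Z] [InnerProductSpace ℂ Z] [NormedAddCommGroup Y']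
    [InnerProductSpace ℂ Y'] [NormedAddCommGroup Z'] [InnerProductSpace ℂ Z']
    [NormedAddCommGroup W] [InnerProductSpace ℂ W]
    {f : Y ⊗[ℂ] Z →ₗ[ℂ] V} {g : Y' ⊗[ℂ] Z' →ₗ[ℂ] V}
    {f' : Y ⊗[ℂ] Z →ₗ[ℂ] W} {g' : Y' ⊗[ℂ] Z' →ₗ[ℂ] W}
    (h : ∀ y z y' z', ⟪f (y ⊗ₜ z), g (y' ⊗ₜ z')⟫_ℂ = ⟪f' (y ⊗ₜ z), g' (y' ⊗ₜ z')⟫_ℂ)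
    (s : Y ⊗[ℂ] Z) (t : Y' ⊗[ℂ] Z') : ⟪f s, g t⟫_ℂ = ⟪f' s, g' t⟫_ℂ := by
  induction s with
  | zero => simp
  | add s₁ s₂ h₁ h₂ => simp only [map_add, inner_add_left, h₁, h₂]
  | tmul y z =>
    induction t with
    | zero => simp
    | add t₁ t₂ h₁ h₂ => simp only [map_add, inner_add_right, h₁, h₂]
    | tmul y' z' => exact h y z y' z'

namespace MatrixColumn

variable (B : MatrixColumn V)

/-- The dimension of the range of the initial projector. -/
noncomputable def d : ℕ := Module.finrank ℂ (LinearMap.range B.p)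

/-- An isometry from a Euclidean space onto the range of the initial projector. -/
noncomputable def U : Euc B.d →ₗᵢ[ℂ] V :=
  (LinearMap.range B.p).subtypeₗᵢ.comp
    (stdOrthonormalBasis ℂ (LinearMap.range B.p)).repr.symm.toLinearIsometry

/-- The linear combinations of the partial isometries. -/
noncomputable def act : Euc B.m →ₗ[ℂ] Op V where
  toFun y := ∑ k, y k • B.a k
  map_add' y y' := by simp [add_smul, Finset.sum_add_distrib]
  map_smul' c y := by simp [Finset.smul_sum, mul_smul]

/-- The map `y ⊗ z ↦ ∑ k, y k • a k (U z)`. -/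
noncomputable def embLin : Euc B.m ⊗[ℂ] Euc B.d →ₗ[ℂ] V :=
  TensorProduct.lift (LinearMap.lcomp ℂ V B.U.toLinearMap ∘ₗ B.act)

lemma act_apply (y : Euc B.m) : B.act y = ∑ k, y k • B.a k := rfl

@[simp] lemma embLin_tmul (y : Euc B.m) (z : Euc B.d) : B.embLin (y ⊗ₜ z) = B.act y (B.U z) := rfl

lemma U_mem (z : Euc B.d) : B.U z ∈ LinearMap.range B.p :=
  Subtype.coe_prop ((stdOrthonormalBasis ℂ (LinearMap.range B.p)).repr.symm z)

lemma exists_U_eq {v : V} (hv : v ∈ LinearMap.range B.p) : ∃ z, B.U z = v :=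
  ⟨(stdOrthonormalBasis ℂ (LinearMap.range B.p)).repr ⟨v, hv⟩,
    congrArg Subtype.val (LinearIsometryEquiv.symm_apply_apply _ (⟨v, hv⟩ : LinearMap.range B.p))⟩

namespace IsMinimalIn

variable {B} (hB : B.IsMinimalIn A)
include hB

lemma p_U (z : Euc B.d) : B.p (B.U z) = B.U z := by
  obtain ⟨w, hw⟩ := B.U_mem z
  rw [← hw]
  exact LinearMap.congr_fun hB.p_mul_p w

lemma act_mem (y : Euc B.m) : B.act y ∈ A :=
  B.act_apply y ▸ A.sum_mem fun k _ => A.smul_mem _ (hB.a_mem k)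

lemma star_act_mul (y y' : Euc B.m) : star (B.act y) * B.act y' = ⟪y, y'⟫_ℂ • B.p := by
  simp only [act_apply, star_sum, star_smul, Finset.sum_mul_sum, smul_mul_assoc, mul_smul_comm,
    hB.star_a_mul, smul_ite, smul_zero, Finset.sum_ite_eq, Finset.mem_univ, if_true,
    PiLp.inner_apply, Finset.sum_smul, smul_smul]
  refine Finset.sum_congr rfl fun k _ => ?_
  simp

lemma inner_embLin (s t : Euc B.m ⊗[ℂ] Euc B.d) : ⟪B.embLin s, B.embLin t⟫_ℂ = ⟪s, t⟫_ℂ := by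
  refine inner_eq_of_inner_tmul (f' := LinearMap.id) (g' := LinearMap.id) ?_ s t
  intro y z y' z'
  rw [embLin_tmul, embLin_tmul, ← inner_star_apply, ← Module.End.mul_apply, ← star_star (B.act y),
    star_star, hB.star_act_mul, LinearMap.smul_apply, hB.p_U, inner_smul_right,
    LinearIsometry.inner_map_map]
  simp

end IsMinimalIn

/-- The isometric embedding `y ⊗ z ↦ ∑ k, y k • a k (U z)`. -/
noncomputable def emb (hB : B.IsMinimalIn A) : Euc B.m ⊗[ℂ] Euc B.d →ₗᵢ[ℂ] V :=
  B.embLin.isometryOfInner hB.inner_embLin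

variable {B} (hB : B.IsMinimalIn A)

@[simp] lemma emb_tmul (y : Euc B.m) (z : Euc B.d) :
    B.emb hB (y ⊗ₜ z) = B.act y (B.U z) := rfl

/-- Each `(a k)* v` lies in the range of `p`, hence is `U z` for some `z`, and `a k (U z)` is the
image of `e k ⊗ z`. -/
lemma unit_apply_mem_range_emb (v : V) :
    B.unit v ∈ LinearMap.range (B.emb hB).toLinearMap := by
  rw [unit, LinearMap.sum_apply]
  refine Submodule.sum_mem _ fun k _ => ?_
  have h1 : star (B.a k) v ∈ LinearMap.range B.p := by
    refine ⟨star (B.a k) v, ?_⟩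
    have := congrArg star (hB.a_mul_p k)
    rw [star_mul, hB.star_p] at this
    exact LinearMap.congr_fun this v
  obtain ⟨z, hz⟩ := B.exists_U_eq h1
  refine ⟨EuclideanSpace.single k 1 ⊗ₜ z, ?_⟩
  change B.act _ (B.U z) = _
  rw [hz, act_apply]
  simp [PiLp.single_apply]

include hB in
lemma U_comp_adjoint : B.U.toLinearMap ∘ₗ LinearMap.adjoint B.U.toLinearMap = B.p := by
  have hUs : ∀ z, LinearMap.adjoint B.U.toLinearMap (B.U z) = z := by
    intro z
    refine ext_inner_left ℂ fun w => ?_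
    rw [LinearMap.adjoint_inner_right]
    exact B.U.inner_map_map w z
  ext v
  obtain ⟨z, hz⟩ := B.exists_U_eq ⟨v, rfl⟩
  have h0 : LinearMap.adjoint B.U.toLinearMap v = z := by
    refine ext_inner_left ℂ fun w => ?_
    rw [LinearMap.adjoint_inner_right, ← B.U.inner_map_map w z, hz]
    change ⟪B.U w, v⟫_ℂ = _
    rw [← hB.p_U w, ← inner_star_apply, hB.star_p, ← inner_star_apply, hB.star_p]
    exact congrArg _ (LinearMap.congr_fun hB.p_mul_p v).symm
  rw [LinearMap.comp_apply, h0]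
  exact hz

end MatrixColumn

section Tensor

variable {Y Z : Type*} [NormedAddCommGroup Y] [InnerProductSpace ℂ Y] [FiniteDimensional ℂ Y]
  [NormedAddCommGroup Z] [InnerProductSpace ℂ Z] [FiniteDimensional ℂ Z]

lemma ketbra_tmul (y y' : Y) (z z' : Z) :
    ketbra (y ⊗ₜ[ℂ] z) (y' ⊗ₜ[ℂ] z') = TensorProduct.map (ketbra y y') (ketbra z z') := by
  ext u v
  simp [TensorProduct.smul_tmul', TensorProduct.tmul_smul, smul_smul, mul_comm]

lemma extendOp_ketbra (W : Y →ₗᵢ[ℂ] V) (u v : Y) :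
    extendOp W (ketbra u v) = ketbra (W u) (W v) := by
  ext x
  change W (⟪v, LinearMap.adjoint W.toLinearMap x⟫_ℂ • u) = _
  rw [LinearMap.adjoint_inner_right, map_smul]; rfl

lemma compressOp_ketbra (W : Y →ₗᵢ[ℂ] V) (u v : V) :
    compressOp W (ketbra u v) =
      ketbra (LinearMap.adjoint W.toLinearMap u) (LinearMap.adjoint W.toLinearMap v) := by
  ext x
  change LinearMap.adjoint W.toLinearMap (⟪v, W x⟫_ℂ • u) = _
  rw [map_smul, ketbra_apply, LinearMap.adjoint_inner_left]; rfl

lemma adjoint_apply_self (W : Y →ₗᵢ[ℂ] V) (u : Y) :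
    LinearMap.adjoint W.toLinearMap (W u) = u := by
  refine ext_inner_left ℂ fun w => ?_
  rw [LinearMap.adjoint_inner_right]
  exact W.inner_map_map w u

lemma compressOp_extendOp (W : Y →ₗᵢ[ℂ] V) (a : Op Y) : compressOp W (extendOp W a) = a := by
  ext x
  change LinearMap.adjoint W.toLinearMap (W (a (LinearMap.adjoint W.toLinearMap (W x)))) = _
  rw [adjoint_apply_self, adjoint_apply_self]

end Tensor

/-- Translates a block operator into the shape `a (·) b*` in which the value of `Φ` is computed. -/
lemma MatrixColumn.extendOp_map_ketbra {B : MatrixColumn V} (hB : B.IsMinimalIn A)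
    (y y' : Euc B.m) (ρ : Op (Euc B.d)) :
    extendOp (B.emb hB) (TensorProduct.map (ketbra y y') ρ) =
      B.act y * extendOp B.U ρ * star (B.act y') := by
  conv_lhs => rw [eq_sum_ketbra (EuclideanSpace.basisFun (Fin B.d) ℂ) ρ]
  conv_rhs => rw [eq_sum_ketbra (EuclideanSpace.basisFun (Fin B.d) ℂ) ρ]
  have hmap : ∀ σ : Op (Euc B.d), TensorProduct.map (ketbra y y') σ =
      TensorProduct.mapBilinear (RingHom.id ℂ) _ _ _ _ (ketbra y y') σ := fun _ => rfl
  rw [hmap]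
  simp only [map_sum, Finset.mul_sum, Finset.sum_mul]
  refine Finset.sum_congr rfl fun k _ => ?_
  rw [← hmap, ← ketbra_tmul, extendOp_ketbra, extendOp_ketbra, mul_ketbra,
    ketbra_mul, star_star, emb_tmul, emb_tmul]

end Embedding

/-! ### Evaluating `Φ` through the fixed algebra of its compressed dual. -/

section Channel

variable {V : Type*} [NormedAddCommGroup V] [InnerProductSpace ℂ V] [FiniteDimensional ℂ V]
  {Φ : SuperOp V}

/-- The fixed points of the compressed dual form a self-adjoint algebra. -/
noncomputable def dualAlgebra (Φ : SuperOp V) : Submodule ℂ (Op V) := LinearMap.range (compDual Φ)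

lemma compDual_mem (x : Op V) : compDual Φ x ∈ dualAlgebra Φ := ⟨x, rfl⟩

section Algebra

variable (hcp : SumPositive Φ) (hproj : Φ ∘ₗ Φ = Φ)
include hcp hproj

lemma compDual_of_mem {a : Op V} (ha : a ∈ dualAlgebra Φ) : compDual Φ a = a := by
  obtain ⟨x, rfl⟩ := ha
  exact compDual_compDual hcp hproj x

lemma suppProj_mul_of_mem {a : Op V} (ha : a ∈ dualAlgebra Φ) : suppProj Φ * a = a := by
  rw [← compDual_of_mem hcp hproj ha, suppProj_mul_compDual]

lemma mul_suppProj_of_mem {a : Op V} (ha : a ∈ dualAlgebra Φ) : a * suppProj Φ = a := by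
  rw [← compDual_of_mem hcp hproj ha, compDual_mul_suppProj]

lemma trace_compDual_mul_of_mem {p : Op V} (hp : p ∈ dualAlgebra Φ) (x : Op V) :
    LinearMap.trace ℂ V (compDual Φ x * p) = LinearMap.trace ℂ V (x * Φ p) := by
  rw [compDual_apply, mul_assoc, suppProj_mul_of_mem hcp hproj hp, mul_assoc,
    LinearMap.trace_mul_comm, mul_assoc, mul_suppProj_of_mem hcp hproj hp, trace_dualOp_mul]

variable (htp : IsTracePreserving Φ)
include htp

lemma isStarClosed_dualAlgebra : IsStarClosed (dualAlgebra Φ) where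
  mul_mem {a b} ha hb := ⟨a * b, by
    rw [compDual_mul_right hcp htp hproj (compDual_of_mem hcp hproj hb),
      compDual_of_mem hcp hproj ha]⟩
  star_mem {a} ha := ⟨star a, by
    rw [(sumPositive_compDual hcp).map_star, compDual_of_mem hcp hproj ha]⟩

lemma suppProj_mem_dualAlgebra : suppProj Φ ∈ dualAlgebra Φ :=
  ⟨1, by rw [compDual_apply, dualOp_one htp, mul_one, suppProj_mul_self]⟩

/-- Dual to the module property: `Tr (x p Φ(p)) = Tr (F(x p) p) = Tr (F(x) p p) = Tr (x Φ(p))`. -/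
lemma mul_map_of_mem {p : Op V} (hp : p ∈ dualAlgebra Φ) (hpp : p * p = p) :
    p * Φ p = Φ p := by
  apply op_ext_trace
  intro x
  rw [← mul_assoc, ← trace_compDual_mul_of_mem hcp hproj hp,
    ← trace_compDual_mul_of_mem hcp hproj hp,
    compDual_mul_right hcp htp hproj (compDual_of_mem hcp hproj hp), mul_assoc, hpp]

lemma map_mul_of_mem {p : Op V} (hp : p ∈ dualAlgebra Φ) (hpp : p * p = p) (hps : star p = p) :
    Φ p * p = Φ p := by
  have := congrArg star (mul_map_of_mem hcp hproj htp hp hpp)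
  rwa [star_mul, ← hcp.map_star, hps] at this

/-- Moving `Φ` to the dual gives `⟨w, b* Φ*(x) a z⟩`. Elements of the algebra absorb `P`, so `Φ*`
may be replaced by `F`, and the bimodule property brings `a` and `b*` inside. -/
lemma trace_mul_map_ketbra {a b : Op V} (ha : a ∈ dualAlgebra Φ) (hb : b ∈ dualAlgebra Φ)
    (x : Op V) (z w : V) :
    LinearMap.trace ℂ V (x * Φ (ketbra (a z) (b w))) = ⟪w, compDual Φ (star b * x * a) z⟫_ℂ := by
  have hA := isStarClosed_dualAlgebra hcp hproj htp
  have h1 : compDual Φ (star b * x * a) = star b * dualOp Φ x * a := by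
    rw [compDual_mul_right hcp htp hproj (compDual_of_mem hcp hproj ha),
      compDual_mul_left hcp htp hproj (compDual_of_mem hcp hproj (hA.star_mem hb)), compDual_apply,
      mul_assoc, mul_assoc, mul_assoc, suppProj_mul_of_mem hcp hproj ha, ← mul_assoc,
      mul_suppProj_of_mem hcp hproj (hA.star_mem hb), mul_assoc]
  rw [h1, Module.End.mul_apply, Module.End.mul_apply, inner_star_apply, inner_dualOp]

lemma map_ketbra_eq_zero {a b p q : Op V} (ha : a ∈ dualAlgebra Φ) (hb : b ∈ dualAlgebra Φ)
    (hqs : star q = q) (h : ∀ x ∈ dualAlgebra Φ, q * x * p = 0) {z w : V} (hz : p z = z)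
    (hw : q w = w) : Φ (ketbra (a z) (b w)) = 0 := by
  apply op_ext_trace
  intro x
  rw [trace_mul_map_ketbra hcp hproj htp ha hb, mul_zero, map_zero, ← hw, ← hz, ← inner_star_apply,
    hqs, ← Module.End.mul_apply, ← Module.End.mul_apply, h _ (compDual_mem _)]
  simp

/-- Minimality gives `p F(b* x a) p = c p`. Evaluating it between `w` and `z` gives `c ⟨w, z⟩`,
taking its trace gives `c Tr p = Tr (x a Φ(p) b*)`; eliminate `c`. -/
lemma trace_smul_map_ketbra {a b p : Op V} (ha : a ∈ dualAlgebra Φ) (hb : b ∈ dualAlgebra Φ)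
    (hp : p ∈ dualAlgebra Φ) (hpp : p * p = p) (hps : star p = p)
    (hmin : ∀ x ∈ dualAlgebra Φ, ∃ c : ℂ, p * x * p = c • p) {z w : V} (hz : p z = z)
    (hw : p w = w) :
    LinearMap.trace ℂ V p • Φ (ketbra (a z) (b w)) = ⟪w, z⟫_ℂ • (a * Φ p * star b) := by
  apply op_ext_trace
  intro x
  obtain ⟨c, hc⟩ := hmin _ (compDual_mem (Φ := Φ) (star b * x * a))
  have h1 : ⟪w, compDual Φ (star b * x * a) z⟫_ℂ = c * ⟪w, z⟫_ℂ := by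
    conv_lhs => rw [← hw, ← hz, ← inner_star_apply, hps, ← Module.End.mul_apply,
      ← Module.End.mul_apply, hc, LinearMap.smul_apply, inner_smul_right, hz]
  have h2 : LinearMap.trace ℂ V (x * (a * Φ p * star b)) = c * LinearMap.trace ℂ V p := by
    have h3 : LinearMap.trace ℂ V (p * compDual Φ (star b * x * a) * p) =
        LinearMap.trace ℂ V (x * (a * Φ p * star b)) := by
      rw [mul_assoc, LinearMap.trace_mul_comm, mul_assoc, hpp,
        trace_compDual_mul_of_mem hcp hproj hp, mul_assoc, mul_assoc, LinearMap.trace_mul_comm]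
      simp only [mul_assoc]
    rw [← h3, hc, map_smul, smul_eq_mul]
  rw [mul_smul_comm, mul_smul_comm, map_smul, map_smul, h2,
    trace_mul_map_ketbra hcp hproj htp ha hb, h1]
  simp only [smul_eq_mul]
  ring

/-- `Φ p` is faithful on the range of a minimal projector `p`. -/
lemma eq_zero_of_map_apply_eq_zero {p : Op V} (hp : p ∈ dualAlgebra Φ) (hpp : p * p = p)
    (hmin : ∀ x ∈ dualAlgebra Φ, ∃ c : ℂ, p * x * p = c • p) (hp0 : LinearMap.trace ℂ V p ≠ 0)
    (hps : star p = p) {v : V} (hv : p v = v) (h : Φ p v = 0) : v = 0 := by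
  -- This operator is `c p`, and duality gives `c Tr p = ⟨v, Φ(p) v⟩ = 0`.
  have hF0 : compDual Φ (ketbra v v) = 0 := by
    obtain ⟨c, hc⟩ := hmin _ (compDual_mem (Φ := Φ) (ketbra v v))
    have hfix := compDual_of_mem hcp hproj hp
    have h1 : p * compDual Φ (ketbra v v) * p = compDual Φ (ketbra v v) := by
      rw [← compDual_mul_left hcp htp hproj hfix, ← compDual_mul_right hcp htp hproj hfix,
        mul_ketbra, ketbra_mul, hps, hv]
    have h2 := trace_compDual_mul_of_mem hcp hproj hp (ketbra v v)
    rw [LinearMap.trace_mul_comm _ _ (Φ p), trace_mul_ketbra, h, inner_zero_right, ← h1, hc,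
      smul_mul_assoc, hpp, map_smul, smul_eq_mul, mul_eq_zero, or_iff_left hp0] at h2
    rw [← h1, hc, h2, zero_smul]
  have hσ : star (Φ 1) = Φ 1 := by rw [← hcp.map_star, star_one]
  -- By invariance `|v⟩⟨v|` has zero expectation against `Φ(1)`, so `Φ(1) v = 0`. But `v` also lies
  -- in the range of the self-adjoint `Φ(1)`, which forces `v = 0`.
  have h3 : ketbra v v * Φ 1 = 0 := by
    apply mul_eq_zero_of_trace_mul_eq_zero hcp.isPositive_one
    · rw [LinearMap.isPositive_iff]
      refine ⟨(LinearMap.isSymmetric_iff_isSelfAdjoint _).mpr (star_ketbra v v), fun x => ?_⟩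
      rw [ketbra_apply, inner_smul_left, inner_conj_symm, ← inner_conj_symm v x]
      exact mul_star_self_nonneg _
    · rw [← trace_compDual_mul hcp hproj, hF0, zero_mul, map_zero]
  rw [ketbra_mul, hσ] at h3
  by_contra hv0
  have h4 : Φ 1 v = 0 := by
    have := LinearMap.congr_fun h3 (Φ 1 v)
    rw [ketbra_apply, LinearMap.zero_apply, smul_eq_zero, or_iff_left hv0] at this
    exact inner_self_eq_zero.mp this
  obtain ⟨w, hw⟩ := suppProj_apply_mem Φ v
  have h5 : suppProj Φ v = v := by
    rw [← hv, ← Module.End.mul_apply, suppProj_mul_of_mem hcp hproj hp]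
  rw [h5] at hw
  apply hv0
  rw [← inner_self_eq_zero (𝕜 := ℂ)]
  nth_rw 1 [← hw]
  rw [← hσ, star_apply_inner, h4, inner_zero_right]

end Algebra

lemma isPositive_map_projector (hcp : SumPositive Φ) {p : Op V} (hpp : p * p = p)
    (hps : star p = p) : (Φ p).IsPositive := by
  rw [LinearMap.isPositive_iff]
  constructor
  · rw [LinearMap.isSymmetric_iff_isSelfAdjoint]
    change star _ = _
    rw [← hcp.map_star, hps]
  · intro v
    have := hcp.one p v
    rw [hps, hpp] at this
    rw [← inner_conj_symm]
    exact star_nonneg_iff.mpr this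

namespace MatrixColumn

variable {A : Submodule ℂ (Op V)} {B : MatrixColumn V}

lemma IsMinimalIn.trace_p (hB : B.IsMinimalIn A) : LinearMap.trace ℂ V B.p = (B.d : ℂ) := by
  rw [← U_comp_adjoint hB, LinearMap.trace_comp_comm']
  have : LinearMap.adjoint B.U.toLinearMap ∘ₗ B.U.toLinearMap = LinearMap.id :=
    LinearMap.ext (adjoint_apply_self B.U)
  rw [this, LinearMap.trace_id]
  simp

lemma IsMinimalIn.d_pos (hB : B.IsMinimalIn A) : 0 < B.d := by
  rw [Nat.pos_iff_ne_zero]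
  intro h
  have := Submodule.finrank_eq_zero.mp h
  exact hB.p_ne_zero (LinearMap.range_eq_bot.mp this)

lemma IsMinimalIn.trace_p_ne_zero (hB : B.IsMinimalIn A) : LinearMap.trace ℂ V B.p ≠ 0 := by
  rw [hB.trace_p]
  exact_mod_cast hB.d_pos.ne'

/-- The normalized compression of `Φ p`. -/
noncomputable def density (Φ : SuperOp V) (B : MatrixColumn V) : Op (Euc B.d) :=
  (B.d : ℂ)⁻¹ • compressOp B.U (Φ B.p)

variable (hcp : SumPositive Φ) (hproj : Φ ∘ₗ Φ = Φ) (htp : IsTracePreserving Φ)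
  (hB : B.IsMinimalIn (dualAlgebra Φ))
include hcp hproj htp hB

lemma extendOp_density : extendOp B.U (density Φ B) = (B.d : ℂ)⁻¹ • Φ B.p := by
  have h : extendOp B.U (compressOp B.U (Φ B.p)) = B.p * Φ B.p * B.p := by
    rw [← U_comp_adjoint hB]; rfl
  rw [density, map_smul, h, mul_map_of_mem hcp hproj htp hB.p_mem hB.p_mul_p,
    map_mul_of_mem hcp hproj htp hB.p_mem hB.p_mul_p hB.star_p]

lemma isDensityOperator_density : IsDensityOperator (density Φ B) := by
  constructor
  · refine LinearMap.IsPositive.smul_of_nonneg ?_ ?_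
    · exact (isPositive_map_projector hcp hB.p_mul_p hB.star_p).adjoint_conj B.U.toLinearMap
    · rw [inv_nonneg]; exact_mod_cast B.d.zero_le
  · have h : LinearMap.trace ℂ _ (compressOp B.U (Φ B.p)) = LinearMap.trace ℂ V (Φ B.p * B.p) := by
      rw [← U_comp_adjoint hB]
      exact (LinearMap.trace_comp_comm' (LinearMap.adjoint B.U.toLinearMap)
        (Φ (B.U.toLinearMap ∘ₗ LinearMap.adjoint B.U.toLinearMap) ∘ₗ B.U.toLinearMap)).symm
    rw [density, map_smul, h, map_mul_of_mem hcp hproj htp hB.p_mem hB.p_mul_p hB.star_p, htp,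
      hB.trace_p, smul_eq_mul, inv_mul_cancel₀]
    exact_mod_cast hB.d_pos.ne'

lemma isFullRank_density : IsFullRank (density Φ B) := by
  have hinj : Function.Injective (density Φ B) := by
    rw [← LinearMap.ker_eq_bot, LinearMap.ker_eq_bot']
    intro z hz
    have hd : (B.d : ℂ) ≠ 0 := by exact_mod_cast hB.d_pos.ne'
    have h1 : Φ B.p (B.U z) = 0 := by
      have := LinearMap.congr_fun (extendOp_density hcp hproj htp hB) (B.U z)
      change B.U (density Φ B (LinearMap.adjoint B.U.toLinearMap (B.U z))) = _ at this
      rw [adjoint_apply_self, hz, map_zero, LinearMap.smul_apply, eq_comm, smul_eq_zero,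
        or_iff_right (inv_ne_zero hd)] at this
      exact this
    have := eq_zero_of_map_apply_eq_zero hcp hproj htp hB.p_mem hB.p_mul_p hB.minimal
      hB.trace_p_ne_zero hB.star_p (hB.p_U z) h1
    exact (map_eq_zero_iff B.U B.U.injective).mp this
  rw [IsFullRank, LinearMap.range_eq_top.mpr (LinearMap.injective_iff_surjective.mp hinj),
    finrank_top]

lemma map_ketbra_emb (y y' : Euc B.m) (z z' : Euc B.d) :
    Φ (ketbra (B.emb hB (y ⊗ₜ z)) (B.emb hB (y' ⊗ₜ z'))) =
      extendOp (B.emb hB) (TensorProduct.map (ketbra y y') (⟪z', z⟫_ℂ • density Φ B)) := by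
  have h := trace_smul_map_ketbra hcp hproj htp (hB.act_mem y) (hB.act_mem y') hB.p_mem
    hB.p_mul_p hB.star_p hB.minimal (hB.p_U z) (hB.p_U z')
  rw [hB.trace_p, B.U.inner_map_map] at h
  have hd : (B.d : ℂ) ≠ 0 := by exact_mod_cast hB.d_pos.ne'
  rw [extendOp_map_ketbra, map_smul, extendOp_density hcp hproj htp hB, emb_tmul, emb_tmul]
  rw [mul_smul_comm, smul_mul_assoc, mul_smul_comm, smul_mul_assoc, smul_comm, ← h, smul_smul,
    inv_mul_cancel₀ hd, one_smul]

lemma range_emb_le : LinearMap.range (B.emb hB).toLinearMap ≤ LinearMap.range (Φ 1) := by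
  rintro _ ⟨t, rfl⟩
  change B.emb hB t ∈ _
  induction t with
  | zero => simp
  | add s t hs ht => rw [map_add]; exact Submodule.add_mem _ hs ht
  | tmul y z =>
    rw [emb_tmul, ← suppProj_mul_of_mem hcp hproj (hB.act_mem y)]
    exact suppProj_apply_mem _ _

end MatrixColumn

end Channel

/-! ### Block forms: fixed space, uniqueness of the support, existence. -/

section BlockForm

variable {V : Type*} [NormedAddCommGroup V] [InnerProductSpace ℂ V] [FiniteDimensional ℂ V]

lemma superTensor_traceReplace_map {Y Z : Type*} [NormedAddCommGroup Y] [InnerProductSpace ℂ Y]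
    [FiniteDimensional ℂ Y] [NormedAddCommGroup Z] [InnerProductSpace ℂ Z] [FiniteDimensional ℂ Z]
    (ρ : Op Z) (A : Op Y) (B : Op Z) :
    superTensor LinearMap.id (traceReplace ρ) (TensorProduct.map A B) =
      TensorProduct.map A (LinearMap.trace ℂ Z B • ρ) :=
  superTensor_map _ _ _ _

lemma exists_superTensor_traceReplace_eq {Y Z : Type*} [NormedAddCommGroup Y]
    [InnerProductSpace ℂ Y] [FiniteDimensional ℂ Y] [NormedAddCommGroup Z] [InnerProductSpace ℂ Z]
    [FiniteDimensional ℂ Z] (ρ : Op Z) (a : Op (Y ⊗[ℂ] Z)) :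
    ∃ A : Op Y, superTensor LinearMap.id (traceReplace ρ) a = TensorProduct.map A ρ := by
  obtain ⟨t, rfl⟩ := (homTensorHomEquiv ℂ Y Z Y Z).surjective a
  induction t with
  | zero => exact ⟨0, by simp⟩
  | add s t hs ht =>
    obtain ⟨A, hA⟩ := hs
    obtain ⟨B, hB⟩ := ht
    exact ⟨A + B, by rw [map_add, map_add, hA, hB, TensorProduct.map_add_left]⟩
  | tmul A B =>
    refine ⟨LinearMap.trace ℂ Z B • A, ?_⟩
    have : homTensorHomEquiv ℂ Y Z Y Z (A ⊗ₜ B) = TensorProduct.map A B := by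
      simp [homTensorHomEquiv_apply]
    rw [this, superTensor_traceReplace_map, TensorProduct.map_smul_right,
      TensorProduct.map_smul_left]

namespace TensorDecomposition

variable {X : Submodule ℂ V} (D : TensorDecomposition X)

lemma emb_mem (i : Fin D.n) (t : Euc (D.dimY i) ⊗[ℂ] Euc (D.dimZ i)) : D.emb i t ∈ X :=
  D.iSup_range.le (Submodule.mem_iSup_of_mem i ⟨t, rfl⟩)

lemma adjoint_emb_of_ne {i j : Fin D.n} (h : i ≠ j) (t : Euc (D.dimY i) ⊗[ℂ] Euc (D.dimZ i)) :
    LinearMap.adjoint (D.emb j).toLinearMap (D.emb i t) = 0 := by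
  refine ext_inner_left ℂ fun w => ?_
  rw [LinearMap.adjoint_inner_right, inner_zero_right]
  exact D.orthogonal h.symm w t

lemma extendOp_mem_operatorsOn (i : Fin D.n) (a : Op (Euc (D.dimY i) ⊗[ℂ] Euc (D.dimZ i))) :
    extendOp (D.emb i) a ∈ operatorsOn X := by
  refine ⟨fun v => D.emb_mem i _, fun v hv => ?_⟩
  have : LinearMap.adjoint (D.emb i).toLinearMap v = 0 := by
    refine ext_inner_left ℂ fun w => ?_
    rw [LinearMap.adjoint_inner_right, inner_zero_right]
    exact (Submodule.mem_orthogonal _ _).mp hv _ (D.emb_mem i w)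
  change D.emb i (a (LinearMap.adjoint (D.emb i).toLinearMap v)) = 0
  rw [this, map_zero, map_zero]

lemma compressOp_extendOp_of_ne {i j : Fin D.n} (h : i ≠ j)
    (a : Op (Euc (D.dimY i) ⊗[ℂ] Euc (D.dimZ i))) :
    compressOp (D.emb j) (extendOp (D.emb i) a) = 0 := by
  refine LinearMap.ext fun x => ?_
  exact D.adjoint_emb_of_ne h _

lemma superOp_extendOp (ρ : ∀ i, Op (Euc (D.dimZ i))) (i : Fin D.n)
    (a : Op (Euc (D.dimY i) ⊗[ℂ] Euc (D.dimZ i))) :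
    D.superOp ρ (extendOp (D.emb i) a) =
      extendOp (D.emb i) (superTensor LinearMap.id (traceReplace (ρ i)) a) := by
  rw [superOp, LinearMap.sum_apply, Finset.sum_eq_single i]
  · rw [LinearMap.comp_apply, LinearMap.comp_apply, compressOp_extendOp]
  · intro j _ hj
    rw [LinearMap.comp_apply, LinearMap.comp_apply, D.compressOp_extendOp_of_ne hj.symm, map_zero,
      map_zero]
  · simp

lemma superOp_ketbra_of_ne (ρ : ∀ i, Op (Euc (D.dimZ i))) {i j : Fin D.n} (h : i ≠ j)
    (s : Euc (D.dimY i) ⊗[ℂ] Euc (D.dimZ i)) (t : Euc (D.dimY j) ⊗[ℂ] Euc (D.dimZ j)) :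
    D.superOp ρ (ketbra (D.emb i s) (D.emb j t)) = 0 := by
  rw [superOp, LinearMap.sum_apply]
  refine Finset.sum_eq_zero fun k _ => ?_
  rw [LinearMap.comp_apply, LinearMap.comp_apply, compressOp_ketbra]
  by_cases hik : i = k
  · rw [D.adjoint_emb_of_ne (hik ▸ h.symm) t, ketbra_zero_right, map_zero, map_zero]
  · rw [D.adjoint_emb_of_ne hik s, ketbra_zero_left, map_zero, map_zero]

lemma mem_block (ρ : ∀ i, Op (Euc (D.dimZ i))) (i : Fin D.n) (μ : Op V) :
    μ ∈ D.block ρ i ↔ ∃ A, extendOp (D.emb i) (TensorProduct.map A (ρ i)) = μ :=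
  Iff.rfl

lemma superOp_mem_iSup_block (ρ : ∀ i, Op (Euc (D.dimZ i))) (μ : Op V) :
    D.superOp ρ μ ∈ ⨆ i, D.block ρ i := by
  rw [superOp, LinearMap.sum_apply]
  refine Submodule.sum_mem _ fun i _ => Submodule.mem_iSup_of_mem i ?_
  obtain ⟨A, hA⟩ := exists_superTensor_traceReplace_eq (ρ i) (compressOp (D.emb i) μ)
  exact (D.mem_block ρ i _).mpr ⟨A, by rw [LinearMap.comp_apply, LinearMap.comp_apply, hA]⟩

/-- Compression to the `i`-th summand kills the other blocks and is injective on block `i`. -/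
lemma iSupIndep_block (ρ : ∀ i, Op (Euc (D.dimZ i))) : iSupIndep (D.block ρ) := by
  intro i
  rw [Submodule.disjoint_def]
  intro μ hμ hμ'
  have hle : ⨆ j, ⨆ (_ : j ≠ i), D.block ρ j ≤ LinearMap.ker (compressOp (D.emb i)) := by
    refine iSup₂_le fun j hj => ?_
    rintro _ ⟨A, rfl⟩
    exact D.compressOp_extendOp_of_ne hj _
  obtain ⟨A, rfl⟩ := (D.mem_block ρ i μ).mp hμ
  have := hle hμ'
  rw [LinearMap.mem_ker, compressOp_extendOp] at this
  rw [this, map_zero]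

end TensorDecomposition

variable {Φ : SuperOp V} {X : Submodule ℂ V} {D : TensorDecomposition X}
  {ρ : ∀ i, Op (Euc (D.dimZ i))}

lemma HasBlockForm.map_extendOp (h : HasBlockForm Φ D ρ) (i : Fin D.n)
    (A : Op (Euc (D.dimY i))) : Φ (extendOp (D.emb i) (TensorProduct.map A (ρ i))) =
      extendOp (D.emb i) (TensorProduct.map A (ρ i)) := by
  rw [h.2 _ (D.extendOp_mem_operatorsOn i _), D.superOp_extendOp, superTensor_traceReplace_map,
    (h.1 i).1.2, one_smul]

/-- A fixed operator is a value of `Φ`, hence lies in `L(X)`, where the block form applies and takes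
values in the sum of the blocks. Conversely `A ⊗ ρ i` is fixed because `Tr (ρ i) = 1`. -/
theorem HasBlockForm.fixedSpace_eq (h : HasBlockForm Φ D ρ)
    (hX : LinearMap.range Φ ≤ operatorsOn X) : fixedSpace Φ = ⨆ i, D.block ρ i := by
  apply le_antisymm
  · intro μ hμ
    have hμ : Φ μ = μ := hμ
    rw [← hμ, h.2 μ (hX ⟨μ, hμ⟩)]
    exact D.superOp_mem_iSup_block ρ μ
  · refine iSup_le fun i => ?_
    rintro _ ⟨A, rfl⟩
    exact h.map_extendOp i A

/-- The support in a block form is the range of `Φ 1`. -/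
theorem HasBlockForm.eq_range (h : HasBlockForm Φ D ρ) (hcp : SumPositive Φ)
    (hX : LinearMap.range Φ ≤ operatorsOn X) : X = LinearMap.range (Φ 1) := by
  apply le_antisymm
  · rw [← D.iSup_range]
    refine iSup_le fun i => ?_
    rintro _ ⟨t, rfl⟩
    -- Full rank makes `id ⊗ ρ i` surjective on its summand. It is fixed by `Φ`, so its range lies
    -- in that of `Φ 1`.
    have hsurj : Function.Surjective (TensorProduct.map LinearMap.id (ρ i) :
        Op (Euc (D.dimY i) ⊗[ℂ] Euc (D.dimZ i))) :=
      TensorProduct.map_surjective Function.surjective_id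
        (LinearMap.range_eq_top.mp (Submodule.eq_top_of_finrank_eq (h.1 i).2))
    obtain ⟨s, hs⟩ := hsurj t
    have h1 := (hcp.range_le ⟨_, h.map_extendOp i LinearMap.id⟩).1 (D.emb i s)
    change D.emb i (TensorProduct.map LinearMap.id (ρ i)
      (LinearMap.adjoint (D.emb i).toLinearMap (D.emb i s))) ∈ _ at h1
    rw [adjoint_apply_self, hs] at h1
    exact h1
  · rintro _ ⟨v, rfl⟩
    exact (hX ⟨1, rfl⟩).1 v

lemma superOp_eq_of_eq_on_tmul {S T : SuperOp V}
    (h : ∀ i j y z y' z', S (ketbra (D.emb i (y ⊗ₜ z)) (D.emb j (y' ⊗ₜ z'))) =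
      T (ketbra (D.emb i (y ⊗ₜ z)) (D.emb j (y' ⊗ₜ z')))) {μ : Op V}
    (hμ : μ ∈ operatorsOn X) : S μ = T μ := by
  refine superOp_eq_on_operatorsOn ?_ hμ
  intro v hv w hw
  rw [← D.iSup_range] at hv hw
  induction hv using Submodule.iSup_induction' with
  | zero => simp
  | add v₁ v₂ _ _ h₁ h₂ => rw [ketbra_add_left, map_add, map_add, h₁, h₂]
  | mem i v hv =>
    obtain ⟨s, rfl⟩ := hv
    induction hw using Submodule.iSup_induction' with
    | zero => simp
    | add w₁ w₂ _ _ h₁ h₂ => rw [ketbra_add_right, map_add, map_add, h₁, h₂]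
    | mem j w hw =>
      obtain ⟨t, rfl⟩ := hw
      induction s with
      | zero => simp
      | add s₁ s₂ h₁ h₂ => rw [map_add, ketbra_add_left, map_add, map_add, h₁, h₂]
      | tmul y z =>
        induction t with
        | zero => simp
        | add t₁ t₂ h₁ h₂ => rw [map_add, ketbra_add_right, map_add, map_add, h₁, h₂]
        | tmul y' z' => exact h i j y z y' z'

lemma TensorDecomposition.eq_superOp_of_eq_on_tmul (D : TensorDecomposition X)
    {ρ : ∀ i, Op (Euc (D.dimZ i))}
    (h₁ : ∀ i y y' z z', Φ (ketbra (D.emb i (y ⊗ₜ z)) (D.emb i (y' ⊗ₜ z'))) =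
      extendOp (D.emb i) (TensorProduct.map (ketbra y y') (⟪z', z⟫_ℂ • ρ i)))
    (h₂ : ∀ i j, i ≠ j → ∀ y z y' z',
      Φ (ketbra (D.emb i (y ⊗ₜ z)) (D.emb j (y' ⊗ₜ z'))) = 0)
    {μ : Op V} (hμ : μ ∈ operatorsOn X) : Φ μ = D.superOp ρ μ := by
  refine superOp_eq_of_eq_on_tmul (D := D) ?_ hμ
  intro i j y z y' z'
  by_cases hij : i = j
  · subst hij
    rw [h₁, ← extendOp_ketbra, D.superOp_extendOp, ketbra_tmul, superTensor_traceReplace_map,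
      trace_ketbra]
  · rw [D.superOp_ketbra_of_ne _ hij, h₂ i j hij]

lemma exists_hasBlockForm_of_eq_on_tmul {n : ℕ} {dimY dimZ : Fin n → ℕ}
    (emb : ∀ i, (Euc (dimY i) ⊗[ℂ] Euc (dimZ i)) →ₗᵢ[ℂ] V) (ρ : ∀ i, Op (Euc (dimZ i)))
    (horth : OrthogonalFamily ℂ (fun i => Euc (dimY i) ⊗[ℂ] Euc (dimZ i)) emb)
    (hsup : ⨆ i, LinearMap.range (emb i).toLinearMap = X)
    (hd : ∀ i, IsDensityOperator (ρ i)) (hr : ∀ i, IsFullRank (ρ i))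
    (h₁ : ∀ i y y' z z', Φ (ketbra (emb i (y ⊗ₜ z)) (emb i (y' ⊗ₜ z'))) =
      extendOp (emb i) (TensorProduct.map (ketbra y y') (⟪z', z⟫_ℂ • ρ i)))
    (h₂ : ∀ i j, i ≠ j → ∀ y z y' z', Φ (ketbra (emb i (y ⊗ₜ z)) (emb j (y' ⊗ₜ z'))) = 0) :
    ∃ (D : TensorDecomposition X) (ρ : ∀ i, Op (Euc (D.dimZ i))), HasBlockForm Φ D ρ :=
  ⟨⟨n, dimY, dimZ, emb, horth, hsup⟩, ρ, fun i => ⟨hd i, hr i⟩,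
    fun _ hμ => TensorDecomposition.eq_superOp_of_eq_on_tmul _ h₁ h₂ hμ⟩

lemma list_sum_apply_mem {l : List (Op V)} {S : Submodule ℂ V} {v : V}
    (h : ∀ x ∈ l, x v ∈ S) : l.sum v ∈ S := by
  induction l with
  | nil => simp
  | cons x l ih =>
    rw [List.sum_cons]
    exact S.add_mem (h x List.mem_cons_self) (ih fun y hy => h y (List.mem_cons_of_mem x hy))

theorem exists_hasBlockForm (hcp : SumPositive Φ) (htp : IsTracePreserving Φ)
    (hproj : Φ ∘ₗ Φ = Φ) :
    ∃ (D : TensorDecomposition (LinearMap.range (Φ 1))) (ρ : ∀ i, Op (Euc (D.dimZ i))),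
      HasBlockForm Φ D ρ := by
  have hA := isStarClosed_dualAlgebra hcp hproj htp
  obtain ⟨L, hL, hpair, hunit⟩ := hA.exists_columns
  have hLi : ∀ i : Fin L.length, (L.get i).IsMinimalIn (dualAlgebra Φ) := fun i =>
    hL _ (L.get_mem i)
  have hne : ∀ i j : Fin L.length, i ≠ j → ∀ x ∈ dualAlgebra Φ,
      (L.get i).p * x * (L.get j).p = 0 := by
    intro i j hij x hx
    rcases lt_or_gt_of_ne hij with h | h
    · exact List.pairwise_iff_get.mp hpair i j h x hx
    · have := congrArg star (List.pairwise_iff_get.mp hpair j i h _ (hA.star_mem hx))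
      rwa [star_mul, star_mul, star_star, (hLi i).star_p, (hLi j).star_p, star_zero,
        ← mul_assoc] at this
  -- The sum of the units is a right unit for the algebra and `P` is a left unit; both belong to the
  -- algebra, so they coincide.
  have hP : suppProj Φ = (L.map MatrixColumn.unit).sum := by
    rw [← hunit _ (suppProj_mem_dualAlgebra hcp hproj htp)]
    apply suppProj_mul_of_mem hcp hproj
    refine list_sum_mem ?_
    intro x hx
    obtain ⟨B, hB, rfl⟩ := List.mem_map.mp hx
    exact Submodule.sum_mem _ fun k _ =>
      hA.mul_mem ((hL B hB).a_mem k) (hA.star_mem ((hL B hB).a_mem k))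
  refine exists_hasBlockForm_of_eq_on_tmul (dimY := fun i => (L.get i).m)
    (dimZ := fun i => (L.get i).d) (fun i => (L.get i).emb (hLi i))
    (fun i => (L.get i).density Φ) ?_ ?_
    (fun i => MatrixColumn.isDensityOperator_density hcp hproj htp (hLi i))
    (fun i => MatrixColumn.isFullRank_density hcp hproj htp (hLi i)) ?_ ?_
  · intro i j hij s t
    have := inner_eq_of_inner_tmul (f := (L.get i).embLin) (g := (L.get j).embLin)
      (f' := (0 : _ →ₗ[ℂ] V)) (g' := (0 : _ →ₗ[ℂ] V)) ?_ s t
    · exact this.trans (by simp)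
    intro y z y' z'
    rw [MatrixColumn.embLin_tmul, MatrixColumn.embLin_tmul, ← (hLi i).p_U z,
      ← (hLi j).p_U z', ← inner_star_apply, ← (hLi i).star_p, star_apply_inner]
    simp only [← Module.End.mul_apply]
    -- Inserting `U z = p (U z)` on both sides leaves `p x p'` with `x` in the algebra, which is
    -- zero for different summands.
    rw [← mul_assoc, ← mul_assoc, mul_assoc (L.get i).p,
      hne i j hij _ (hA.mul_mem (hA.star_mem ((hLi i).act_mem y)) ((hLi j).act_mem y'))]
    simp
  · apply le_antisymm
    · exact iSup_le fun i => MatrixColumn.range_emb_le hcp hproj htp (hLi i)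
    · intro v hv
      rw [← suppProj_apply_eq hv, hP]
      apply list_sum_apply_mem
      intro x hx
      obtain ⟨B, hB, rfl⟩ := List.mem_map.mp hx
      obtain ⟨i, rfl⟩ := List.get_of_mem hB
      exact Submodule.mem_iSup_of_mem i (MatrixColumn.unit_apply_mem_range_emb (hLi i) v)
  · intro i y y' z z'
    exact MatrixColumn.map_ketbra_emb hcp hproj htp (hLi i) y y' z z'
  · intro i j hij y z y' z'
    exact map_ketbra_eq_zero hcp hproj htp ((hLi i).act_mem y) ((hLi j).act_mem y')
      (hLi j).star_p (hne j i (Ne.symm hij)) ((hLi i).p_U z) ((hLi j).p_U z')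

end BlockForm

end CPTP

theorem theorem4 {V : Type*} [NormedAddCommGroup V] [InnerProductSpace ℂ V]
    [FiniteDimensional ℂ V] (Φ : CPTP.SuperOp V)
    (hcp : CPTP.IsCompletelyPositive Φ) (htp : CPTP.IsTracePreserving Φ)
    (hproj : Φ ∘ₗ Φ = Φ) :
    (∃! X : Submodule ℂ V,
      LinearMap.range Φ ≤ CPTP.operatorsOn X ∧
        ∃ (D : CPTP.TensorDecomposition X) (ρ : ∀ i, CPTP.Op (CPTP.Euc (D.dimZ i))),
          CPTP.HasBlockForm Φ D ρ) ∧
    ∀ (X : Submodule ℂ V) (D : CPTP.TensorDecomposition X)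
      (ρ : ∀ i, CPTP.Op (CPTP.Euc (D.dimZ i))),
      LinearMap.range Φ ≤ CPTP.operatorsOn X → CPTP.HasBlockForm Φ D ρ →
        iSupIndep (D.block ρ) ∧ CPTP.fixedSpace Φ = ⨆ i, D.block ρ i := by
  have hsp := hcp.sumPositive
  refine ⟨⟨LinearMap.range (Φ 1), ⟨hsp.range_le, CPTP.exists_hasBlockForm hsp htp hproj⟩, ?_⟩,
    fun X D ρ hX h => ⟨D.iSupIndep_block ρ, h.fixedSpace_eq hX⟩⟩
  rintro X ⟨hX, D, ρ, h⟩
  exact h.eq_range hsp hX
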